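/- Let $d,\alpha\in\mathbb N$ with $d,\alpha\ge 1$, let $\rho(\boldsymbol x)=(2\pi)^{-d/2}\mathrm e^{-|\boldsymbol x|^2/2}$ and let $H_\rho^\alpha(\mathbb R^d)$ be the space of functions $f$ whose weak derivatives $D^{\mathbf r}f$, $\mathbf r\in\{0,\dots,\alpha\}^d$, all lie in $L^2_\rho(\mathbb R^d)$, with norm $\|f\|_{H^\alpha_\rho}=\bigl(\sum_{\mathbf r\in\{0,\dots,\alpha\}^d}\int_{\mathbb R^d}|D^{\mathbf r}f|^2\rho\,\mathrm d\boldsymbol x\bigr)^{1/2}$. Put $I(f)=\int_{\mathbb R^d}f\rho\,\mathrm d\boldsymbol x$, $\phi(t)=-\cot(\pi t)$, and, for $f\in H^\alpha_\rho(\mathbb R^d)$, $$g_f(\boldsymbol t)=f(\phi(t_1),\dots,\phi(t_d))\,\rho(\phi(t_1),\dots,\phi(t_d))\prod_{k=1}^d\phi'(t_k)\quad(\boldsymbol t\in(0,1)^d),$$ extended by zero to the boundary of $[0,1]^d$. Let $H^\alpha_{\mathrm{Kor}}$ be the Korobov space of all (complex-valued) $g\in L^2([0,1]^d)$ with $\|g\|_{\mathrm{Kor},\alpha}^2=\sum_{\boldsymbol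 k\in\mathbb Z^d}|\widehat g(\boldsymbol k)|^2\prod_{j=1}^d\max(1,|k_j|^\alpha)^2<\infty$, where $\widehat g(\boldsymbol k)=\int_{[0,1]^d}g(\boldsymbol t)\mathrm e^{-2\pi\mathrm i\boldsymbol t\cdot\boldsymbol k}\mathrm d\boldsymbol t$. The rank-1 lattice with generating vector $\boldsymbol z\in\mathbb N^d$ consists of the points $\boldsymbol t^{(j)}=\{j\boldsymbol z/N\}$, $j=1,\dots,N$ (componentwise fractional part). For $N\ge2$, a vector $\boldsymbol z\in\mathbb N^d$ is obtained by the component-by-component (CBC) construction if $z_1=1$ and, for $s=2,\dots,d$, $z_s$ minimizes over all $w\in\{1,\dots,N-1\}$ with $\gcd(w,N)=1$ the worst-case error over the unit ball of the $s$-variate Korobov space of smoothness $\alpha$ (whose elements are taken to be continuous and $1$-periodic in each variable) of the lattice rule with generating vector $(z_1,\dots,z_{s-1},w)$. Then every $f\in H^\alpha_\rho(\mathbb R^d)$ has a continuous representative, and $g_f\in H^\alpha_{\mathrm{Kor}}$. Moreover, there is a constant $C_{\alpha,d}>0$, depending only on $\alpha$ and $d$, such that for every $N\ge2$ a CBC vector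 exists, and for every CBC vector $\boldsymbol z$ the lattice rule with cotangent transform $Q_N(f)=\frac1N\sum_{j=1}^N g_f(\boldsymbol t^{(j)})$ satisfies $$\sup_{f\ne0}\frac{|I(f)-Q_N(f)|}{\|f\|_{H^\alpha_\rho}}\le C_{\alpha,d}\,N^{-\alpha}(\ln N)^{d\alpha},$$ where the supremum is over all nonzero $f\in H_\rho^\alpha(\mathbb R^d)$, point values being those of the continuous representative. -/

import Mathlib

open MeasureTheory Real
open scoped ENNReal ContDiff

noncomputable section

namespace GaussQMC

/-! ### The Gaussian Sobolev space of dominating mixed smoothness -/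

/-- The standard Gaussian density `ρ(x) = exp(-|x|²/2) / (2π)^{d/2}` on `ℝ^d`,
where `|x|` is the Euclidean norm. -/
def gaussDensity {d : ℕ} (x : Fin d → ℝ) : ℝ :=
  Real.exp (-(∑ i, x i ^ 2) / 2) / (2 * π) ^ ((d : ℝ) / 2)

/-- The classical partial derivative in the `i`-th coordinate direction. -/
def partialD {d : ℕ} (i : Fin d) (φ : (Fin d → ℝ) → ℝ) : (Fin d → ℝ) → ℝ :=
  fun x => fderiv ℝ φ x (Pi.single i 1)

/-- The classical mixed partial derivative `D^r φ = ∂₁^{r₁} ⋯ ∂_d^{r_d} φ`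
(only applied to smooth functions). -/
def mixedD {d : ℕ} (r : Fin d → ℕ) (φ : (Fin d → ℝ) → ℝ) : (Fin d → ℝ) → ℝ :=
  (List.finRange d).foldr (fun i ψ => (partialD i)^[r i] ψ) φ

/-- `g` is a weak derivative `D^r f` on `ℝ^d`. -/
def IsWeakDeriv {d : ℕ} (r : Fin d → ℕ) (f g : (Fin d → ℝ) → ℝ) : Prop :=
  LocallyIntegrable f volume ∧ LocallyIntegrable g volume ∧
    ∀ φ : (Fin d → ℝ) → ℝ, ContDiff ℝ ∞ φ → HasCompactSupport φ →
      ∫ x, f x * mixedD r φ x = (-1) ^ (∑ i, r i) * ∫ x, g x * φ x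

open Classical in
/-- The weak derivative `D^r f` (it is unique up to null sets); zero if there is none. -/
def weakDeriv {d : ℕ} (r : Fin d → ℕ) (f : (Fin d → ℝ) → ℝ) : (Fin d → ℝ) → ℝ :=
  if h : ∃ g, IsWeakDeriv r f g then h.choose else 0

/-- The multi-indices `r ∈ {0, …, α}^d`, i.e. `|r|_∞ ≤ α`. -/
def multiIndices (α d : ℕ) : Finset (Fin d → ℕ) :=
  Fintype.piFinset fun _ => Finset.range (α + 1)

/-- `f ∈ H_ρ^α(ℝ^d)`: all weak derivatives `D^r f` with `|r|_∞ ≤ α` exist and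
lie in `L²_ρ(ℝ^d)`. -/
def MemSobolev {d : ℕ} (α : ℕ) (f : (Fin d → ℝ) → ℝ) : Prop :=
  ∀ r ∈ multiIndices α d, ∃ g, IsWeakDeriv r f g ∧
    Integrable (fun x => g x ^ 2 * gaussDensity x) volume

/-- `‖f‖_{H_ρ^α} = (∑_{|r|_∞ ≤ α} ‖D^r f‖²_{L²_ρ})^{1/2}`. -/
def sobolevNorm {d : ℕ} (α : ℕ) (f : (Fin d → ℝ) → ℝ) : ℝ :=
  Real.sqrt (∑ r ∈ multiIndices α d, ∫ x, weakDeriv r f x ^ 2 * gaussDensity x)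

/-- The Gaussian integral `I(f) = ∫ f ρ`. -/
def gaussIntegral {d : ℕ} (f : (Fin d → ℝ) → ℝ) : ℝ :=
  ∫ x, f x * gaussDensity x

/-! ### Lattice points and the rule with cotangent transform -/

/-- The `j`-th point `{z j / N}` of the rank-1 lattice with generating vector `z`. -/
def latticePoint {d : ℕ} (N : ℕ) (z : Fin d → ℕ) (j : ℕ) : Fin d → ℝ :=
  fun i => Int.fract ((z i : ℝ) * j / N)

/-- `φ(t) = -cot(π t)`. -/
def cotMap (t : ℝ) : ℝ := -Real.cot (π * t)

open Classical in
/-- The transformed integrand `g(t) = f(Ψ(t)) ρ(Ψ(t)) ∏ φ'(t_k)` with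
`Ψ(t) = (φ(t_1), …, φ(t_d))` for `t ∈ (0,1)^d`, extended by zero to the boundary. -/
def cotIntegrand {d : ℕ} (f : (Fin d → ℝ) → ℝ) (t : Fin d → ℝ) : ℝ :=
  if ∀ k, t k ∈ Set.Ioo (0 : ℝ) 1 then
    f (fun k => cotMap (t k)) * gaussDensity (fun k => cotMap (t k)) *
      ∏ k, deriv cotMap (t k)
  else 0

/-- The rank-1 lattice rule with cotangent transform. -/
def cotLatticeRule {d : ℕ} (N : ℕ) (z : Fin d → ℕ) (f : (Fin d → ℝ) → ℝ) : ℝ :=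
  (1 / N : ℝ) * ∑ j ∈ Finset.Icc 1 N, cotIntegrand f (latticePoint N z j)

/-- The worst-case error `sup_{f ≠ 0} |I(f) - Q_N(f)| / ‖f‖_{H_ρ^α}`. Elements of `H_ρ^α` are
represented by their continuous representatives, so that point evaluations make sense. -/
def sobolevWorstCaseError {d : ℕ} (α N : ℕ) (z : Fin d → ℕ) : ℝ≥0∞ :=
  ⨆ (f : (Fin d → ℝ) → ℝ) (_ : Continuous f) (_ : MemSobolev α f) (_ : f ≠ 0),
    ENNReal.ofReal (|gaussIntegral f - cotLatticeRule N z f| / sobolevNorm α f)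

/-! ### The Korobov space and the component-by-component construction -/

/-- The Fourier coefficient `∫_{[0,1]^d} g(t) exp(-2πi t·k) dt`. -/
def cubeFourierCoeff {d : ℕ} (g : (Fin d → ℝ) → ℂ) (k : Fin d → ℤ) : ℂ :=
  ∫ t in Set.Icc (0 : Fin d → ℝ) 1,
    g t * Complex.exp (-(2 * π * Complex.I * ((∑ i, t i * (k i : ℝ) : ℝ) : ℂ)))

/-- `r_α(k) = ∏ max(1, |k_j|^α)`. -/
def korobovWeight {d : ℕ} (α : ℕ) (k : Fin d → ℤ) : ℝ :=
  ∏ j, max 1 (|(k j : ℝ)| ^ α)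

/-- `g` (restricted to the unit cube) belongs to the Korobov space of smoothness `α`. -/
def MemKorobov {d : ℕ} (α : ℕ) (g : (Fin d → ℝ) → ℂ) : Prop :=
  MemLp g 2 (volume.restrict (Set.Icc (0 : Fin d → ℝ) 1)) ∧
    Summable fun k : Fin d → ℤ => ‖cubeFourierCoeff g k‖ ^ 2 * korobovWeight α k ^ 2

/-- The Korobov norm. -/
def korobovNorm {d : ℕ} (α : ℕ) (g : (Fin d → ℝ) → ℂ) : ℝ :=
  Real.sqrt (∑' k : Fin d → ℤ, ‖cubeFourierCoeff g k‖ ^ 2 * korobovWeight α k ^ 2)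

/-- The worst-case error, over the unit ball of the Korobov space of smoothness `α`, of the rank-1
lattice rule with generating vector `z`. Elements of the Korobov space are represented by
their continuous 1-periodic representatives. -/
def korobovWorstCaseError {d : ℕ} (α N : ℕ) (z : Fin d → ℕ) : ℝ≥0∞ :=
  ⨆ (g : (Fin d → ℝ) → ℂ) (_ : Continuous g)
    (_ : ∀ (i : Fin d) (t : Fin d → ℝ), g (t + Pi.single i 1) = g t)
    (_ : MemKorobov α g) (_ : korobovNorm α g ≤ 1),
    ENNReal.ofReal ‖(∫ t in Set.Icc (0 : Fin d → ℝ) 1, g t) -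
      (1 / N : ℂ) * ∑ j ∈ Finset.Icc 1 N, g (latticePoint N z j)‖

/-- The admissible components of a generating vector: `1 ≤ w < N` with `gcd(w, N) = 1`
(all of `{1, …, N-1}` when `N` is prime). -/
def IsCandidate (N w : ℕ) : Prop := 1 ≤ w ∧ w < N ∧ Nat.Coprime w N

/-- The vector `(z_1, …, z_j, w)`, in dimension `j + 1`. -/
def extendPrefix {d : ℕ} (z : Fin d → ℕ) (j : Fin d) (w : ℕ) : Fin (j.val + 1) → ℕ :=
  Fin.snoc (α := fun _ => ℕ) (fun i : Fin j.val => z ⟨i.val, i.isLt.trans j.isLt⟩) w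

/-- `z` is an output of the component-by-component algorithm: the first component is `1`, and each
further component is a candidate that minimizes the Korobov worst-case error of the lattice rule
in the dimension reached, the earlier components being kept fixed. Ties are broken arbitrarily. -/
def IsCBC {d : ℕ} (α N : ℕ) (z : Fin d → ℕ) : Prop :=
  ∀ j : Fin d,
    (j.val = 0 → z j = 1) ∧
    (j.val ≠ 0 → IsCandidate N (z j) ∧
      ∀ w, IsCandidate N w →
        korobovWorstCaseError α N (extendPrefix z j (z j)) ≤
          korobovWorstCaseError α N (extendPrefix z j w))

end GaussQMC

end

open MeasureTheory Real
open scoped ENNReal ContDiff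

noncomputable section

namespace GaussQMC

/-! ### Averages over the admissible components of a generating vector -/

/-! The cotangent transform is a change of variables between the open cube and `ℝ^d`, so the Fourier
coefficients of the transformed integrand are integrals over `ℝ^d` of `f` against tensor products of
Gaussians and waves `exp(-2πi k φ⁻¹(x))`. The derivative of such a wave is `-2ik/(1+x²)` times the
wave. A factor `k` can therefore be traded for a derivative at the cost of polynomial factors
(`mul_gaussPoly`), and `α` such factors per coordinate fall on `f` as weak derivatives of order at
most `α` in each variable. Parseval on the cube bounds each resulting sum of squares by an `L²_ρ`
norm: squaring produces the Gaussian twice, and the spare copy absorbs the polynomials and the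
Jacobian. Hence the Korobov norm of the transformed integrand is at most a constant times the
Sobolev norm of `f` (`exists_korobov_le`).

For `α ≥ 1` the Fourier series converges absolutely. This yields the continuous representative and,
once the series is shown to vanish on the boundary (`MemSobolev.eqOn_waveSeries`), makes point
values at lattice points legitimate. The quadrature error is the sum of the coefficients over the
nonzero dual lattice, and Cauchy–Schwarz bounds it by the Korobov norm times `√(latSum (2α) N z)`.

The squared Korobov worst-case error equals that `latSum`, and appending a component `w` adds
`latLast` to it, so each CBC step minimizes `latLast`. The minimum is compared with a mean over the
units modulo `N`, taken at the smaller exponent `1+δ` and then raised to the power `2α/(1+δ)`. The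
mean is at most of order `ζ(1+δ)^(n+1) N^(δ-1)`; with `δ = 1/(1 + ln N)` the zeta factor is `O(ln
N)` and `N^δ` is bounded, giving `N^(-2α) (ln N)^(2αd)`. For composite `N` the mean needs an
arithmetic argument (`sum_units_tsum_le`) in which the factor `φ(M)/M` from a sieve cancels a count
of units. -/

/-- The weight `max(1, |h|)^{-s}`. -/
def hypWeight (s : ℝ) (h : ℤ) : ℝ≥0∞ := ENNReal.ofReal (max 1 |(h : ℝ)| ^ (-s))

/-- The weight `|h|^{-s}` of a nonzero integer, and `0` at `h = 0`. -/
def hypWeight' (s : ℝ) (h : ℤ) : ℝ≥0∞ := if h = 0 then 0 else hypWeight s h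

/-- `∑_{h ≠ 0} |h|^{-s}`. -/
def twoZeta (s : ℝ) : ℝ≥0∞ := ∑' h : ℤ, hypWeight' s h

lemma hypWeight_zero (s : ℝ) : hypWeight s 0 = 1 := by simp [hypWeight]

lemma one_le_abs_intCast {h : ℤ} (hh : h ≠ 0) : (1 : ℝ) ≤ |(h : ℝ)| := by
  exact_mod_cast Int.one_le_abs hh

lemma hypWeight'_of_ne {s : ℝ} {h : ℤ} (hh : h ≠ 0) :
    hypWeight' s h = ENNReal.ofReal (|(h : ℝ)| ^ (-s)) := by
  rw [hypWeight', if_neg hh, hypWeight, max_eq_right (one_le_abs_intCast hh)]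

/-- Complete multiplicativity, which makes the Euler-type sieve work; it is the reason for giving
`0` the weight `0` here. -/
lemma hypWeight'_mul (s : ℝ) (g h : ℤ) :
    hypWeight' s (g * h) = hypWeight' s g * hypWeight' s h := by
  rcases eq_or_ne g 0 with rfl | hg
  · simp [hypWeight']
  rcases eq_or_ne h 0 with rfl | hh
  · simp [hypWeight']
  rw [hypWeight'_of_ne (mul_ne_zero hg hh), hypWeight'_of_ne hg, hypWeight'_of_ne hh,
    ← ENNReal.ofReal_mul (by positivity)]
  push_cast
  rw [abs_mul, Real.mul_rpow (abs_nonneg _) (abs_nonneg _)]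

lemma hypWeight'_neg (s : ℝ) (h : ℤ) : hypWeight' s (-h) = hypWeight' s h := by
  rcases eq_or_ne h 0 with rfl | hh
  · simp
  · rw [hypWeight'_of_ne (neg_ne_zero.mpr hh), hypWeight'_of_ne hh]; simp

lemma tsum_hypWeight (s : ℝ) : ∑' h : ℤ, hypWeight s h = 1 + twoZeta s := by
  rw [ENNReal.tsum_eq_add_tsum_ite 0, hypWeight_zero, twoZeta]
  refine congrArg _ (tsum_congr fun h => ?_)
  by_cases hh : h = 0 <;> simp [hypWeight', hh]

/-- Comparison with `∫ x^(-1-δ)`. The dependence on `δ` is kept explicit because `δ` will shrink as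
`N` grows. -/
lemma twoZeta_le {δ : ℝ} (hδ : 0 < δ) :
    twoZeta (1 + δ) ≤ ENNReal.ofReal (2 * (1 + 1 / δ)) := by
  have anti : AntitoneOn (fun x : ℝ => x ^ (-(1 + δ))) (Set.Ici ((1 : ℕ) : ℝ)) := by
    intro x hx y hy hxy
    simp only [Nat.cast_one, Set.mem_Ici] at hx
    exact Real.rpow_le_rpow_of_nonpos (by linarith) hxy (by linarith)
  have hint : IntegrableOn (fun x : ℝ => x ^ (-(1 + δ))) (Set.Ioi ((1 : ℕ) : ℝ)) :=
    integrableOn_Ioi_rpow_of_lt (by linarith) (by norm_num)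
  have hnn : ∀ t ∈ Set.Ioi ((1 : ℕ) : ℝ), 0 ≤ t ^ (-(1 + δ)) := fun t ht =>
    Real.rpow_nonneg (le_trans (by norm_num) (le_of_lt ht)) _
  have h1 := AntitoneOn.tsum_comp_add_le_integral 1 anti hint hnn
  rw [integral_Ioi_rpow_of_lt (by linarith) (by norm_num)] at h1
  have hsum := AntitoneOn.summable_of_integrableOn_Ioi anti hint hnn
  have h2 : ∑' n : ℕ, hypWeight' (1 + δ) ((n : ℤ) + 1) ≤ ENNReal.ofReal (1 + 1 / δ) := by
    have e : ∀ n : ℕ, hypWeight' (1 + δ) ((n : ℤ) + 1)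
        = ENNReal.ofReal (((n + 1 : ℕ) : ℝ) ^ (-(1 + δ))) := by
      intro n
      rw [hypWeight'_of_ne (by positivity)]
      congr 2
      push_cast
      exact abs_of_nonneg (by positivity)
    simp_rw [e]
    rw [← ENNReal.ofReal_tsum_of_nonneg (fun n => by positivity)
      ((summable_nat_add_iff (f := fun n : ℕ => (n : ℝ) ^ (-(1 + δ))) 1).mpr hsum)]
    apply ENNReal.ofReal_le_ofReal
    rw [Summable.tsum_eq_zero_add
      ((summable_nat_add_iff (f := fun n : ℕ => (n : ℝ) ^ (-(1 + δ))) 1).mpr hsum)]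
    have e2 : -((1 : ℕ) : ℝ) ^ (-(1 + δ) + 1) / (-(1 + δ) + 1) = 1 / δ := by
      rw [Nat.cast_one, Real.one_rpow]
      rw [show -(1 + δ) + 1 = -δ by ring, neg_div_neg_eq]
    rw [e2] at h1
    have e3 : (((0 + 1 : ℕ)) : ℝ) ^ (-(1 + δ)) = 1 := by norm_num
    rw [e3]
    gcongr
  rw [twoZeta, tsum_of_add_one_of_neg_add_one ENNReal.summable ENNReal.summable]
  simp_rw [hypWeight'_neg]
  rw [show hypWeight' (1 + δ) 0 = 0 by simp [hypWeight'], add_zero]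
  calc _ ≤ ENNReal.ofReal (1 + 1 / δ) + ENNReal.ofReal (1 + 1 / δ) := add_le_add h2 h2
    _ = _ := by
      rw [← ENNReal.ofReal_add (by positivity) (by positivity)]
      congr 1; ring

/-! ### Sieving integers and averaging over units modulo `N` -/

lemma tsum_mul_int_left {f : ℤ → ℝ≥0∞} {g : ℤ} (hg : g ≠ 0) (hf : ∀ h, f h ≠ 0 → g ∣ h) :
    ∑' h, f h = ∑' h, f (g * h) := by
  rw [Function.Injective.tsum_eq (g := fun h : ℤ => g * h) (mul_right_injective₀ hg)]
  intro h hh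
  obtain ⟨c, rfl⟩ := hf h hh
  exact ⟨c, rfl⟩

open Classical in
/-- The sum of `|h|^{-s}` over the nonzero integers without a divisor in `S`. -/
lemma tsum_not_dvd_le {s : ℝ} (hs : 0 ≤ s) (hZ : twoZeta s ≠ ⊤) (S : Finset ℕ)
    (hS : ∀ p ∈ S, p.Prime) :
    ∑' h : ℤ, (if ∀ p ∈ S, ¬ (p : ℤ) ∣ h then hypWeight' s h else 0)
      ≤ ENNReal.ofReal (∏ p ∈ S, (1 - (p : ℝ) ^ (-s))) * twoZeta s := by
  induction S using Finset.induction_on with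
  | empty => simp [twoZeta]
  | insert p S hp ih =>
    have ih' := ih fun q hq => hS q (Finset.mem_insert_of_mem hq)
    have hpp := hS p (Finset.mem_insert_self _ _)
    set T := ∑' h : ℤ, (if ∀ q ∈ S, ¬ (q : ℤ) ∣ h then hypWeight' s h else 0) with hT
    have hp0 : (p : ℤ) ≠ 0 := by exact_mod_cast hpp.ne_zero
    have hTfin : T ≠ ⊤ := by
      refine ne_top_of_le_ne_top hZ (ENNReal.tsum_le_tsum fun h => ?_)
      split_ifs <;> simp
    have hp1 : (p : ℝ) ^ (-s) ≤ 1 :=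
      Real.rpow_le_one_of_one_le_of_nonpos (by exact_mod_cast hpp.one_lt.le) (by linarith)
    have hw : hypWeight' s (p : ℤ) = ENNReal.ofReal ((p : ℝ) ^ (-s)) := by
      rw [hypWeight'_of_ne hp0]; simp
    -- Among the integers already sieved by `S`, the multiples of `p` contribute exactly `p^(-s) T`,
    -- since `p` is prime to every element of `S`; the remaining ones therefore contribute `(1 -
    -- p^(-s)) T`.
    have split : T = ∑' h : ℤ, (if ∀ q ∈ insert p S, ¬ (q : ℤ) ∣ h then hypWeight' s h else 0)
        + hypWeight' s p * T := by
      have e : hypWeight' s p * T = ∑' h : ℤ,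
          (if (p : ℤ) ∣ h ∧ ∀ q ∈ S, ¬ (q : ℤ) ∣ h then hypWeight' s h else 0) := by
        rw [tsum_mul_int_left hp0, hT, ← ENNReal.tsum_mul_left]
        · refine tsum_congr fun h => ?_
          have : (∀ q ∈ S, ¬ (q : ℤ) ∣ h) ↔ (p : ℤ) ∣ p * h ∧ ∀ q ∈ S, ¬ (q : ℤ) ∣ p * h := by
            simp only [dvd_mul_right, true_and]
            refine forall₂_congr fun q hq => not_congr ?_
            have hqp := hS q (Finset.mem_insert_of_mem hq)
            have hne : q ≠ p := fun h => hp (h ▸ hq)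
            have hcop : IsCoprime (q : ℤ) p :=
              Nat.isCoprime_iff_coprime.mpr ((Nat.coprime_primes hqp hpp).mpr hne)
            exact ⟨fun h => h.mul_left _, fun h => hcop.dvd_of_dvd_mul_left h⟩
          rw [hypWeight'_mul]
          by_cases h0 : ∀ q ∈ S, ¬ (q : ℤ) ∣ h
          · rw [if_pos h0, if_pos (this.mp h0)]
          · rw [if_neg h0, if_neg (mt this.mpr h0), mul_zero]
        · intro h hh
          by_contra hc
          simp [hc] at hh
      rw [e, hT, ← ENNReal.tsum_add]
      refine tsum_congr fun h => ?_
      simp only [Finset.forall_mem_insert]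
      by_cases h1 : (p : ℤ) ∣ h <;> by_cases h2 : ∀ q ∈ S, ¬ (q : ℤ) ∣ h <;> simp [h1, h2]
    rw [Finset.prod_insert hp, ENNReal.ofReal_mul (by linarith), mul_assoc]
    refine le_trans ?_ (mul_le_mul_right ih' _)
    rw [ENNReal.ofReal_sub _ (by positivity), ENNReal.ofReal_one, ← hw, ENNReal.sub_mul
      (fun _ _ => hTfin), one_mul]
    refine ENNReal.le_sub_of_add_le_right ?_ split.ge
    exact ENNReal.mul_ne_top (by rw [hw]; exact ENNReal.ofReal_ne_top) hTfin

/-- With `a = p^δ ≥ 1` the claim reads `(a - a⁻¹)/p ≤ a - 1`, and `a - a⁻¹ = (a - 1)(1 + a⁻¹) ≤ 2(a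
- 1)` while `p ≥ 2`. -/
lemma one_sub_rpow_le {p δ : ℝ} (hp : 2 ≤ p) (hδ : 0 ≤ δ) :
    1 - p ^ (-(1 + δ)) ≤ p ^ δ * (1 - p⁻¹) := by
  have hp0 : 0 < p := by linarith
  have ha : 1 ≤ p ^ δ := Real.one_le_rpow (by linarith) hδ
  have e : p ^ (-(1 + δ)) = p⁻¹ * (p ^ δ)⁻¹ := by
    rw [neg_add, Real.rpow_add hp0, Real.rpow_neg_one, Real.rpow_neg hp0.le]
  rw [e]
  set a := p ^ δ
  have h2 : p⁻¹ ≤ 1 / 2 := by rw [inv_le_comm₀ hp0 (by norm_num)]; linarith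
  have h3 : 0 < p⁻¹ := by positivity
  have h4 : a⁻¹ ≤ 1 := inv_le_one_of_one_le₀ ha
  have h5 : a * a⁻¹ = 1 := mul_inv_cancel₀ (by linarith)
  have h6 : a - a⁻¹ ≤ 2 * (a - 1) := by
    have : 0 ≤ (a - 1) * (1 - a⁻¹) := mul_nonneg (by linarith) (by linarith)
    nlinarith
  nlinarith

/-- Replaces the Euler product at `1+δ` by the one at `1`, which is `φ(M)/M`. The loss `M^δ` is
harmless for the later choice of `δ`. -/
lemma prod_primeFactors_le {M : ℕ} (hM : M ≠ 0) {δ : ℝ} (hδ : 0 ≤ δ) :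
    ∏ p ∈ M.primeFactors, (1 - (p : ℝ) ^ (-(1 + δ))) ≤ (M : ℝ) ^ δ * (M.totient / M) := by
  have ht : (M.totient : ℝ) / M = ∏ p ∈ M.primeFactors, (1 - (p : ℝ)⁻¹) := by
    have h := congrArg (fun q : ℚ => (q : ℝ)) (Nat.totient_eq_mul_prod_factors M)
    push_cast at h
    rw [h]; field_simp
  have hp : ∀ p ∈ M.primeFactors, (2 : ℝ) ≤ p := fun p hp => by
    exact_mod_cast (Nat.prime_of_mem_primeFactors hp).two_le
  have hM' : ∏ p ∈ M.primeFactors, (p : ℝ) ^ δ ≤ (M : ℝ) ^ δ := by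
    rw [Real.finsetProd_rpow _ _ (fun p _ => by positivity)]
    gcongr
    have := Nat.le_of_dvd (Nat.pos_of_ne_zero hM) (Nat.prod_primeFactors_dvd M)
    calc _ = ((∏ p ∈ M.primeFactors, p : ℕ) : ℝ) := by push_cast; rfl
      _ ≤ _ := by exact_mod_cast this
  have hnn : ∀ p ∈ M.primeFactors, 0 ≤ 1 - (p : ℝ)⁻¹ := fun p hpm => by
    have := hp p hpm
    have : (p : ℝ)⁻¹ ≤ 1 := inv_le_one_of_one_le₀ (by linarith)
    linarith
  rw [ht]
  calc _ ≤ ∏ p ∈ M.primeFactors, ((p : ℝ) ^ δ * (1 - (p : ℝ)⁻¹)) := by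
        refine Finset.prod_le_prod (fun p hpm => ?_) fun p hpm => one_sub_rpow_le (hp p hpm) hδ
        have := hp p hpm
        have := Real.rpow_le_one_of_one_le_of_nonpos (x := (p : ℝ)) (z := -(1 + δ)) (by linarith)
          (by linarith)
        linarith
    _ = (∏ p ∈ M.primeFactors, (p : ℝ) ^ δ) * ∏ p ∈ M.primeFactors, (1 - (p : ℝ)⁻¹) :=
        Finset.prod_mul_distrib
    _ ≤ _ := mul_le_mul_of_nonneg_right hM' (Finset.prod_nonneg hnn)

/-- Reduction of units is a surjective homomorphism, so all its fibres have the same size. -/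
lemma card_fiber_unitsMap {M N : ℕ} [NeZero N] (h : M ∣ N) (y : (ZMod M)ˣ) :
    M.totient * (Finset.univ.filter fun u : (ZMod N)ˣ => ZMod.unitsMap h u = y).card
      = N.totient := by
  classical
  have : NeZero M := ⟨fun hM => NeZero.ne N (by subst hM; exact zero_dvd_iff.mp h)⟩
  have hs := ZMod.unitsMap_surjective h
  have hsum := Finset.card_eq_sum_card_fiberwise (s := (Finset.univ : Finset (ZMod N)ˣ))
    (f := ZMod.unitsMap h) (t := Finset.univ) (fun _ _ => Finset.mem_coe.mpr (Finset.mem_univ _))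
  rw [← ZMod.card_units_eq_totient N, ← ZMod.card_units_eq_totient M,
    ← Finset.card_univ (α := (ZMod N)ˣ), hsum, Finset.sum_congr rfl fun x _ =>
    MonoidHom.card_fiber_eq_of_mem_range (ZMod.unitsMap h) (hs x) (hs y)]
  simp

open Classical in
/-- The average, over the admissible `w`, of the sum of `|h|^{-(1+δ)}` over the solutions `h ≠ 0` of
`c + h w ≡ 0 mod N`. -/
lemma sum_units_tsum_le {N : ℕ} [NeZero N] {δ : ℝ} (hδ : 0 < δ) (c : ℤ) :
    ∑ u : (ZMod N)ˣ, ∑' h : ℤ,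
        (if (N : ℤ) ∣ c + h * (u : ZMod N).val then hypWeight' (1 + δ) h else 0)
      ≤ N.totient * (ENNReal.ofReal ((N : ℝ) ^ δ / N) * twoZeta (1 + δ)) := by
  set s := 1 + δ with hs
  have hN : N ≠ 0 := NeZero.ne N
  have hZ : twoZeta s ≠ ⊤ := ne_top_of_le_ne_top ENNReal.ofReal_ne_top (twoZeta_le hδ)
  -- Write `N = g M`. Every solution `h` is a multiple of `g`, and `h/g` is prime to `M`; for a
  -- given `h` the admissible `u` all lie in one class modulo `M`.
  set g := Int.gcd c N with hg
  have hgN : g ∣ N := by exact_mod_cast (Int.gcd_dvd_right c (N : ℤ))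
  have hgc : (g : ℤ) ∣ c := Int.gcd_dvd_left c (N : ℤ)
  obtain ⟨M, hM⟩ := hgN
  have hg0 : g ≠ 0 := fun h => hN (by rw [hM, h, zero_mul])
  have hM0 : M ≠ 0 := fun h => hN (by rw [hM, h, mul_zero])
  have hMN : M ∣ N := ⟨g, by rw [hM, mul_comm]⟩
  have hgZ : (g : ℤ) ≠ 0 := by exact_mod_cast hg0
  have hNZ : (N : ℤ) = g * M := by rw [hM]; push_cast; rfl
  have hcopu : ∀ u : (ZMod N)ˣ, IsCoprime ((u : ZMod N).val : ℤ) N := fun u =>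
    Nat.isCoprime_iff_coprime.mpr (ZMod.val_coe_unit_coprime u)
  have hdvd : ∀ (h : ℤ) (u : (ZMod N)ˣ), (N : ℤ) ∣ c + h * (u : ZMod N).val → (g : ℤ) ∣ h := by
    intro h u hu
    have h1 : (g : ℤ) ∣ h * (u : ZMod N).val :=
      (dvd_add_right hgc).mp ((Dvd.intro _ hNZ.symm).trans hu)
    have h2 : IsCoprime (g : ℤ) ((u : ZMod N).val : ℤ) :=
      ((hcopu u).of_isCoprime_of_dvd_right (Dvd.intro _ hNZ.symm)).symm
    exact h2.dvd_of_dvd_mul_right h1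
  -- A prime `p` dividing both `M` and `h/g` would make `g p` a common divisor of `c` and `N`,
  -- contradicting the choice of `g`.
  have hndvd : ∀ (h : ℤ) (u : (ZMod N)ˣ), (N : ℤ) ∣ c + (g * h) * (u : ZMod N).val →
      ∀ p ∈ M.primeFactors, ¬ (p : ℤ) ∣ h := by
    intro h u hu p hp hph
    have hpM : (p : ℤ) ∣ M := by exact_mod_cast Nat.dvd_of_mem_primeFactors hp
    have h1 : (g * p : ℤ) ∣ N := by rw [hNZ]; exact mul_dvd_mul_left _ hpM
    have h2 : (g * p : ℤ) ∣ (g * h) * (u : ZMod N).val := (mul_dvd_mul_left _ hph).mul_right _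
    have h3 : (g * p : ℤ) ∣ c := (dvd_add_left h2).mp (h1.trans hu)
    have h4 : (g * p : ℤ) ∣ g := by rw [hg]; exact Int.dvd_coe_gcd h3 h1
    have h5 : (p : ℤ) ∣ 1 := by
      refine (mul_dvd_mul_iff_left hgZ).mp ?_
      rwa [mul_one]
    have := (Nat.prime_of_mem_primeFactors hp).one_lt
    have := Int.le_of_dvd one_pos h5
    omega
  -- Two solutions `u`, `u₀` for the same `h = g h'` satisfy `M ∣ h'(u - u₀)` with `h'` prime to
  -- `M`, so they lie in one fibre of `ZMod.unitsMap`, which has `φ(N)/φ(M)` elements.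
  have hcard : ∀ h : ℤ, M.totient * (Finset.univ.filter fun u : (ZMod N)ˣ =>
      (N : ℤ) ∣ c + h * (u : ZMod N).val).card ≤ N.totient := by
    intro h
    rcases (Finset.univ.filter fun u : (ZMod N)ˣ =>
      (N : ℤ) ∣ c + h * (u : ZMod N).val).eq_empty_or_nonempty with he | ⟨u₀, hu₀⟩
    · rw [he]; simp
    · rw [← card_fiber_unitsMap hMN (ZMod.unitsMap hMN u₀)]
      refine Nat.mul_le_mul_left _ (Finset.card_le_card fun u hu => ?_)
      replace hu := (Finset.mem_filter.mp hu).2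
      replace hu₀ := (Finset.mem_filter.mp hu₀).2
      refine Finset.mem_filter.mpr ⟨Finset.mem_univ _, ?_⟩
      obtain ⟨h', rfl⟩ := hdvd h u hu
      have hc : IsCoprime h' (M : ℤ) := by
        rw [Int.isCoprime_iff_gcd_eq_one]
        by_contra hne
        obtain ⟨p, hp, hpd⟩ := Nat.exists_prime_and_dvd hne
        have hpd' : (p : ℤ) ∣ Int.gcd h' M := by exact_mod_cast hpd
        refine hndvd h' u hu p ?_ (hpd'.trans (Int.gcd_dvd_left _ _))
        rw [Nat.mem_primeFactors]
        exact ⟨hp, by exact_mod_cast hpd'.trans (Int.gcd_dvd_right _ _), hM0⟩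
      have h1 : (N : ℤ) ∣ g * (h' * ((u : ZMod N).val - (u₀ : ZMod N).val)) := by
        have e : g * (h' * (((u : ZMod N).val : ℤ) - (u₀ : ZMod N).val))
            = (c + g * h' * (u : ZMod N).val) - (c + g * h' * (u₀ : ZMod N).val) := by ring
        rw [e]
        exact dvd_sub hu hu₀
      rw [hNZ, mul_dvd_mul_iff_left hgZ] at h1
      have h2 := hc.symm.dvd_of_dvd_mul_left h1
      ext
      rw [ZMod.unitsMap_val, ZMod.unitsMap_val, ← ZMod.natCast_val, ← ZMod.natCast_val]
      have h3 := (ZMod.intCast_zmod_eq_zero_iff_dvd _ M).mpr h2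
      push_cast at h3
      exact sub_eq_zero.mp h3
  have hMt : 0 < M.totient := Nat.totient_pos.mpr (Nat.pos_of_ne_zero hM0)
  have hterm : ∀ h : ℤ, ∑ u : (ZMod N)ˣ,
      (if (N : ℤ) ∣ c + h * (u : ZMod N).val then hypWeight' s h else 0)
      ≤ ENNReal.ofReal (N.totient / M.totient) *
        (if ∃ u : (ZMod N)ˣ, (N : ℤ) ∣ c + h * (u : ZMod N).val then hypWeight' s h else 0) := by
    intro h
    by_cases hex : ∃ u : (ZMod N)ˣ, (N : ℤ) ∣ c + h * (u : ZMod N).val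
    · rw [if_pos hex, ← Finset.sum_filter, Finset.sum_const, nsmul_eq_mul]
      gcongr
      rw [← ENNReal.ofReal_natCast]
      apply ENNReal.ofReal_le_ofReal
      rw [le_div_iff₀ (by exact_mod_cast hMt), mul_comm]
      exact_mod_cast hcard h
    · rw [if_neg hex]
      rw [mul_zero]
      exact (Finset.sum_eq_zero fun u _ => if_neg fun hu => hex ⟨u, hu⟩).le
  have hdvd' : ∀ h : ℤ, (if ∃ u : (ZMod N)ˣ, (N : ℤ) ∣ c + h * (u : ZMod N).val then
      hypWeight' s h else 0) ≠ 0 → (g : ℤ) ∣ h := by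
    intro h hh
    by_cases hex : ∃ u : (ZMod N)ˣ, (N : ℤ) ∣ c + h * (u : ZMod N).val
    · obtain ⟨u, hu⟩ := hex
      exact hdvd h u hu
    · rw [if_neg hex] at hh; exact absurd rfl hh
  have hterm2 : ∀ h : ℤ, (if ∃ u : (ZMod N)ˣ, (N : ℤ) ∣ c + (g * h) * (u : ZMod N).val then
      hypWeight' s (g * h) else 0) ≤ hypWeight' s g *
      (if ∀ p ∈ M.primeFactors, ¬ (p : ℤ) ∣ h then hypWeight' s h else 0) := by
    intro h
    by_cases hex : ∃ u : (ZMod N)ˣ, (N : ℤ) ∣ c + (g * h) * (u : ZMod N).val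
    · obtain ⟨u, hu⟩ := hex
      rw [if_pos ⟨u, hu⟩, if_pos (hndvd h u hu), hypWeight'_mul]
    · rw [if_neg hex]; exact zero_le
  have hgr : (1 : ℝ) ≤ g := by exact_mod_cast Nat.one_le_iff_ne_zero.mpr hg0
  have hMr : (1 : ℝ) ≤ M := by exact_mod_cast Nat.one_le_iff_ne_zero.mpr hM0
  have hNr : (N : ℝ) = g * M := by exact_mod_cast hNZ
  have hMtr : (0 : ℝ) < M.totient := by exact_mod_cast hMt
  calc _ = ∑' h : ℤ, ∑ u : (ZMod N)ˣ,
        (if (N : ℤ) ∣ c + h * (u : ZMod N).val then hypWeight' s h else 0) :=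
        (Summable.tsum_finsetSum fun _ _ => ENNReal.summable).symm
    _ ≤ ENNReal.ofReal (N.totient / M.totient) * (hypWeight' s g *
        (ENNReal.ofReal (∏ p ∈ M.primeFactors, (1 - (p : ℝ) ^ (-s))) * twoZeta s)) := by
      refine (ENNReal.tsum_le_tsum hterm).trans ?_
      rw [ENNReal.tsum_mul_left, tsum_mul_int_left hgZ hdvd']
      gcongr
      refine (ENNReal.tsum_le_tsum hterm2).trans ?_
      rw [ENNReal.tsum_mul_left]
      gcongr
      exact tsum_not_dvd_le (by linarith) hZ _ fun p hp => Nat.prime_of_mem_primeFactors hp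
    _ ≤ ENNReal.ofReal (N.totient / M.totient) * (hypWeight' s g *
        (ENNReal.ofReal ((M : ℝ) ^ δ * (M.totient / M)) * twoZeta s)) := by
      gcongr
      exact prod_primeFactors_le hM0 hδ.le
    _ = ENNReal.ofReal (N.totient / M.totient * ((g : ℝ) ^ (-s) *
        ((M : ℝ) ^ δ * (M.totient / M)))) * twoZeta s := by
      generalize (M : ℝ) ^ δ * (M.totient / M) = A
      rw [hypWeight'_of_ne hgZ, ENNReal.ofReal_mul (by positivity),
        ENNReal.ofReal_mul (p := (g : ℝ) ^ (-s)) (by positivity)]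
      simp only [Int.cast_natCast, Nat.abs_cast]
      simp only [mul_assoc]
    -- The two occurrences of `φ(M)` cancel; then `g^(-s) ≤ g⁻¹`, `M^δ ≤ N^δ` and `g M = N`.
    _ ≤ ENNReal.ofReal (N.totient * ((N : ℝ) ^ δ / N)) * twoZeta s := by
      refine mul_le_mul_left (ENNReal.ofReal_le_ofReal ?_) _
      have h1 : (g : ℝ) ^ (-s) ≤ (g : ℝ)⁻¹ := by
        rw [← Real.rpow_neg_one]
        exact Real.rpow_le_rpow_of_exponent_le hgr (by linarith)
      have h2 : (M : ℝ) ^ δ ≤ (N : ℝ) ^ δ := by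
        refine Real.rpow_le_rpow (by positivity) ?_ hδ.le
        rw [hNr]; nlinarith
      calc _ ≤ (N.totient : ℝ) / M.totient * ((g : ℝ)⁻¹ * ((N : ℝ) ^ δ * (M.totient / M))) := by
            gcongr
        _ = _ := by
            generalize (N : ℝ) ^ δ = a
            rw [hNr]; field_simp
    _ = _ := by
      rw [ENNReal.ofReal_mul (by positivity), ENNReal.ofReal_natCast, mul_assoc]

/-! ### Dual lattice sums, one component at a time -/

lemma tsum_rpow_le_rpow_tsum {ι : Type*} (a : ι → ℝ≥0∞) {p : ℝ} (hp : 1 ≤ p) :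
    ∑' i, a i ^ p ≤ (∑' i, a i) ^ p := by
  classical
  rw [ENNReal.tsum_eq_iSup_sum]
  refine iSup_le fun s => ?_
  have h1 : ∑ i ∈ s, a i ^ p ≤ (∑ i ∈ s, a i) ^ p := by
    induction s using Finset.induction_on with
    | empty => simp
    | insert i s hi ih =>
      rw [Finset.sum_insert hi, Finset.sum_insert hi]
      exact (add_le_add_right ih _).trans (ENNReal.add_rpow_le_rpow_add _ _ hp)
  exact h1.trans (ENNReal.rpow_le_rpow (ENNReal.sum_le_tsum s) (by linarith))

lemma tsum_pi_prod {n : ℕ} (a : ℤ → ℝ≥0∞) :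
    ∑' h : Fin n → ℤ, ∏ i, a (h i) = (∑' m, a m) ^ n := by
  induction n with
  | zero => simp [tsum_fintype]
  | succ n ih =>
    rw [← (Fin.consEquiv fun _ => ℤ).tsum_eq, ENNReal.tsum_prod']
    simp only [Fin.consEquiv_apply, Fin.prod_univ_succ, Fin.cons_zero, Fin.cons_succ]
    simp_rw [ENNReal.tsum_mul_left, ih, ENNReal.tsum_mul_right]
    rw [pow_succ, mul_comm]

open Classical in
/-- `∑ ∏ max(1, |h_i|)^{-s}` over the nonzero elements `h` of the dual lattice. -/
def latSum {d : ℕ} (s : ℝ) (N : ℕ) (z : Fin d → ℕ) : ℝ≥0∞ :=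
  ∑' h : Fin d → ℤ, if h ≠ 0 ∧ (N : ℤ) ∣ ∑ i, h i * z i then ∏ i, hypWeight s (h i) else 0

open Classical in
/-- The part of `latSum s N (z, w)` with a nonzero last component. -/
def latLast {n : ℕ} (s : ℝ) (N : ℕ) (z : Fin n → ℕ) (w : ℕ) : ℝ≥0∞ :=
  ∑' h : Fin n → ℤ, ∑' m : ℤ,
    if (N : ℤ) ∣ ∑ i, h i * z i + m * w then (∏ i, hypWeight s (h i)) * hypWeight' s m else 0

/-- Split by whether the last coordinate of `h` vanishes. The first summand does not involve `w`, so
a minimization over `w` concerns `latLast` alone. -/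
lemma latSum_snoc {n : ℕ} (s : ℝ) (N : ℕ) (z : Fin n → ℕ) (w : ℕ) :
    latSum s N (Fin.snoc (α := fun _ => ℕ) z w : Fin (n + 1) → ℕ)
      = latSum s N z + latLast s N z w := by
  classical
  unfold latSum latLast
  rw [← (Fin.snocEquiv fun _ => ℤ).tsum_eq, ENNReal.tsum_prod', ENNReal.tsum_comm,
    ← ENNReal.tsum_add]
  refine tsum_congr fun h => ?_
  simp only [Fin.snocEquiv_apply, Fin.sum_univ_castSucc, Fin.prod_univ_castSucc, Fin.snoc_castSucc,
    Fin.snoc_last]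
  have hsn : ∀ m : ℤ, (Fin.snocEquiv fun _ : Fin (n + 1) => ℤ) (m, h) ≠ 0 ↔ h ≠ 0 ∨ m ≠ 0 := by
    intro m
    change (Fin.snoc (α := fun _ => ℤ) h m : Fin (n + 1) → ℤ) ≠ 0 ↔ _
    rw [← not_and_or, not_iff_not]
    constructor
    · intro hm
      refine ⟨?_, by simpa using congrFun hm (Fin.last n)⟩
      ext i; simpa using congrFun hm i.castSucc
    · rintro ⟨rfl, rfl⟩
      ext i; refine Fin.lastCases ?_ (fun i => ?_) i <;> simp
  simp only [hsn]
  rw [ENNReal.tsum_eq_add_tsum_ite 0]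
  congr 1
  · simp [hypWeight_zero]
  · refine tsum_congr fun m => ?_
    by_cases hm : m = 0
    · simp [hm, hypWeight']
    · simp [hm, hypWeight']

lemma latSum_zero_dim (s : ℝ) (N : ℕ) (z : Fin 0 → ℕ) : latSum s N z = 0 := by
  unfold latSum
  rw [ENNReal.tsum_eq_zero]
  intro h
  rw [if_neg]
  rintro ⟨h1, -⟩
  exact h1 (Subsingleton.elim _ _)

lemma hypWeight_mul_rpow (s p : ℝ) (hp : 0 ≤ p) (h : ℤ) :
    hypWeight (s * p) h = hypWeight s h ^ p := by
  unfold hypWeight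
  rw [ENNReal.ofReal_rpow_of_nonneg (by positivity) hp, ← Real.rpow_mul (by positivity), neg_mul]

lemma hypWeight'_mul_rpow (s p : ℝ) (hp : 0 < p) (h : ℤ) :
    hypWeight' (s * p) h = hypWeight' s h ^ p := by
  unfold hypWeight'
  split_ifs
  · rw [ENNReal.zero_rpow_of_pos hp]
  · exact hypWeight_mul_rpow s p hp.le h

/-- The inequality `∑ aᵢ^p ≤ (∑ aᵢ)^p`, often called Jensen's: an estimate at a small exponent,
where the mean over `w` is sharp, transfers to a larger one. -/
lemma latLast_mul_le {n : ℕ} (s : ℝ) {p : ℝ} (hp : 1 ≤ p) (N : ℕ) (z : Fin n → ℕ) (w : ℕ) :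
    latLast (s * p) N z w ≤ latLast s N z w ^ p := by
  classical
  unfold latLast
  refine le_trans (ENNReal.tsum_le_tsum fun h => ?_) (tsum_rpow_le_rpow_tsum _ hp)
  refine le_trans (ENNReal.tsum_le_tsum fun m => ?_) (tsum_rpow_le_rpow_tsum _ hp)
  split_ifs
  · rw [ENNReal.mul_rpow_of_nonneg _ _ (by linarith),
      hypWeight'_mul_rpow s p (by linarith), ← ENNReal.prod_rpow_of_nonneg (by linarith)]
    simp_rw [hypWeight_mul_rpow s p (by linarith)]
    exact le_rfl
  · exact zero_le

/-- Some unit does no worse than the mean. For fixed `h` the mean is controlled by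
`sum_units_tsum_le` with `c = ∑ hᵢ zᵢ`, uniformly in `h`, and the remaining sum over `h` factors. -/
lemma exists_unit_latLast_le {n N : ℕ} [NeZero N] {δ : ℝ} (hδ : 0 < δ) (z : Fin n → ℕ) :
    ∃ u : (ZMod N)ˣ, latLast (1 + δ) N z (u : ZMod N).val ≤
      (1 + twoZeta (1 + δ)) ^ n * (ENNReal.ofReal ((N : ℝ) ^ δ / N) * twoZeta (1 + δ)) := by
  classical
  set B := (1 + twoZeta (1 + δ)) ^ n * (ENNReal.ofReal ((N : ℝ) ^ δ / N) * twoZeta (1 + δ)) with hB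
  by_contra! hcon
  have h1 : ∑ _u : (ZMod N)ˣ, B < ∑ u : (ZMod N)ˣ, latLast (1 + δ) N z (u : ZMod N).val :=
    ENNReal.sum_lt_sum_of_nonempty Finset.univ_nonempty fun u _ => hcon u
  rw [Finset.sum_const, Finset.card_univ, ZMod.card_units_eq_totient, nsmul_eq_mul] at h1
  refine absurd h1 (not_lt.mpr ?_)
  unfold latLast
  rw [← Summable.tsum_finsetSum fun _ _ => ENNReal.summable]
  calc _ ≤ ∑' h : Fin n → ℤ, (∏ i, hypWeight (1 + δ) (h i)) *
        (N.totient * (ENNReal.ofReal ((N : ℝ) ^ δ / N) * twoZeta (1 + δ))) := by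
        refine ENNReal.tsum_le_tsum fun h => ?_
        refine le_trans (le_of_eq ?_) (mul_le_mul_right (sum_units_tsum_le hδ (∑ i, h i * z i)) _)
        rw [Finset.mul_sum]
        refine Finset.sum_congr rfl fun u _ => ?_
        rw [← ENNReal.tsum_mul_left]
        refine tsum_congr fun m => ?_
        split_ifs <;> simp
    _ = _ := by
        rw [ENNReal.tsum_mul_right, tsum_pi_prod, tsum_hypWeight, hB]
        ring

/-- In dimension one every unit gives the same dual lattice. This covers the first CBC component,
which is prescribed to be `1` rather than optimized. -/
lemma latLast_dim_zero {N w : ℕ} (s : ℝ) (hw : Nat.Coprime w N) (z : Fin 0 → ℕ) :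
    latLast s N z w = latLast s N z 1 := by
  classical
  unfold latLast
  refine tsum_congr fun h => tsum_congr fun m => ?_
  have : (N : ℤ) ∣ ∑ i, h i * z i + m * w ↔ (N : ℤ) ∣ ∑ i, h i * z i + m * (1 : ℕ) := by
    simp only [Finset.univ_eq_empty, Finset.sum_empty, zero_add, Nat.cast_one, mul_one]
    exact ⟨fun h => (Nat.isCoprime_iff_coprime.mpr hw).symm.dvd_of_dvd_mul_right h,
      fun h => h.mul_right _⟩
  by_cases hm : (N : ℤ) ∣ ∑ i, h i * z i + m * w
  · rw [if_pos hm, if_pos (this.mp hm)]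
  · rw [if_neg hm, if_neg (mt this.mpr hm)]

lemma isCandidate_unit {N : ℕ} (hN : 2 ≤ N) (u : (ZMod N)ˣ) :
    IsCandidate N (u : ZMod N).val := by
  have : NeZero N := ⟨by omega⟩
  have hc := ZMod.val_coe_unit_coprime u
  refine ⟨Nat.one_le_iff_ne_zero.mpr fun h => ?_, ZMod.val_lt _, hc⟩
  rw [h, Nat.coprime_zero_left] at hc
  omega

/-- The average bound, for the exponent `2α` and in terms of `N` and `ln N`. -/
lemma exists_unit_latLast_two_mul_le {n d α N : ℕ} (hα : 1 ≤ α) (hn : n + 1 ≤ d) (hN : 2 ≤ N)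
    (z : Fin n → ℕ) :
    ∃ u : (ZMod N)ˣ, latLast (2 * α) N z (u : ZMod N).val ≤
      ENNReal.ofReal (10 ^ (2 * α * d) * Real.exp (4 * α) *
        (((N : ℝ) ^ α)⁻¹ * Real.log N ^ (d * α)) ^ 2) := by
  have : NeZero N := ⟨by omega⟩
  have hNr : (2 : ℝ) ≤ N := by exact_mod_cast hN
  have hN0 : (0 : ℝ) < N := by linarith
  have hα' : (1 : ℝ) ≤ α := by exact_mod_cast hα
  set l := Real.log N with hl
  -- From `N ≥ 2`. The lower bound lets constants be absorbed into multiples of `ln N`: it gives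
  -- `2(2 + l) ≤ 10 l - 1`.
  have hl2 : 0.69 ≤ l := by
    have := Real.log_two_gt_d9
    have := Real.log_le_log (by norm_num) hNr
    linarith
  -- This balances the two losses: `1/δ` is of order `ln N`, and `N^δ ≤ e`.
  set δ := 1 / (1 + l) with hδ
  have hδ0 : 0 < δ := by positivity
  have hδ1 : δ ≤ 1 := by rw [hδ, div_le_one (by linarith)]; linarith
  have hδl : δ * l ≤ 1 := by rw [hδ, one_div_mul_eq_div, div_le_one (by linarith)]; linarith
  obtain ⟨u, hu⟩ := exists_unit_latLast_le (N := N) hδ0 z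
  refine ⟨u, ?_⟩
  set p := 2 * α / (1 + δ) with hp
  have hps : (1 + δ) * p = 2 * α := by rw [hp]; field_simp
  have hp1 : 1 ≤ p := by rw [hp, le_div_iff₀ (by linarith)]; linarith
  have hp2 : p ≤ 2 * α := by rw [hp, div_le_iff₀ (by linarith)]; nlinarith
  have hZ : twoZeta (1 + δ) ≤ ENNReal.ofReal (10 * l - 1) := by
    refine (twoZeta_le hδ0).trans (ENNReal.ofReal_le_ofReal ?_)
    rw [hδ, one_div_one_div]; linarith
  have hZ1 : 1 + twoZeta (1 + δ) ≤ ENNReal.ofReal (10 * l) := by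
    calc _ ≤ ENNReal.ofReal 1 + ENNReal.ofReal (10 * l - 1) := by
          rw [ENNReal.ofReal_one]; gcongr
      _ = _ := by rw [← ENNReal.ofReal_add (by norm_num) (by linarith)]; congr 1; ring
  have hNδ : (N : ℝ) ^ δ ≤ Real.exp 1 := by
    rw [Real.rpow_def_of_pos hN0]
    exact Real.exp_le_exp.mpr (by rw [mul_comm]; exact hδl)
  have hbase : latLast (1 + δ) N z (u : ZMod N).val ≤
      ENNReal.ofReal ((10 * l) ^ d * (Real.exp 1 / N)) := by
    refine hu.trans ?_
    calc _ ≤ ENNReal.ofReal (10 * l) ^ n * (ENNReal.ofReal (Real.exp 1 / N) *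
          ENNReal.ofReal (10 * l)) := by
          gcongr
          exact hZ.trans (ENNReal.ofReal_le_ofReal (by linarith))
      _ = ENNReal.ofReal ((10 * l) ^ (n + 1) * (Real.exp 1 / N)) := by
          rw [← ENNReal.ofReal_pow (by linarith), ← ENNReal.ofReal_mul (by positivity),
            ← ENNReal.ofReal_mul (by positivity)]
          congr 1; ring
      _ ≤ _ := by
          gcongr
          linarith
  rw [← hps]
  refine (latLast_mul_le _ hp1 N z _).trans ((ENNReal.rpow_le_rpow hbase (by linarith)).trans ?_)
  rw [ENNReal.ofReal_rpow_of_nonneg (by positivity) (by linarith)]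
  apply ENNReal.ofReal_le_ofReal
  have h1 : ((10 * l) ^ d) ^ p ≤ (10 * l) ^ (2 * α * d) := by
    calc _ ≤ ((10 * l) ^ d) ^ (2 * α : ℝ) :=
          Real.rpow_le_rpow_of_exponent_le (one_le_pow₀ (by linarith)) hp2
      _ = _ := by
        rw [show (2 * α : ℝ) = ((2 * α : ℕ) : ℝ) by push_cast; ring, Real.rpow_natCast, ← pow_mul]
        congr 1; ring
  have h2 : (Real.exp 1 / N) ^ p ≤ Real.exp (4 * α) * (((N : ℝ) ^ α)⁻¹) ^ 2 := by
    have e1 : (((N : ℝ) ^ α)⁻¹) ^ 2 = Real.exp (-(2 * α * l)) := by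
      rw [← Real.exp_log (inv_pos.mpr (pow_pos hN0 α)), Real.log_inv, Real.log_pow, ← Real.exp_nat_mul]
      congr 1; push_cast; ring
    have e2 : Real.exp 1 / N = Real.exp (1 - l) := by
      rw [Real.exp_sub, Real.exp_log hN0]
    rw [e1, e2, ← Real.exp_mul, ← Real.exp_add]
    apply Real.exp_le_exp.mpr
    -- Since `p < 2α`, the power of `N` falls short of `N^(-2α)` by `N^(2α - p) = N^(δ p)`, which is
    -- at most `e^p`. Together with the factor `e^p` coming from `N^δ ≤ e` this accounts for `exp
    -- (4α)`.
    have h3 : l * (2 * α - p) ≤ 2 * α := by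
      have e : 2 * α - p = δ * p := by rw [← hps]; ring
      rw [e]
      calc l * (δ * p) = (δ * l) * p := by ring
        _ ≤ 1 * p := by gcongr
        _ ≤ _ := by linarith
    nlinarith
  calc _ = ((10 * l) ^ d) ^ p * (Real.exp 1 / N) ^ p :=
        Real.mul_rpow (by positivity) (by positivity)
    _ ≤ (10 * l) ^ (2 * α * d) * (Real.exp (4 * α) * (((N : ℝ) ^ α)⁻¹) ^ 2) := by gcongr
    _ = _ := by rw [mul_pow, mul_pow _ _ 2, ← pow_mul l, show d * α * 2 = 2 * α * d by ring]; ring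

/-! ### Fourier series on the unit cube -/

section Torus

/-- Normalized Haar measure on `ℝ / ℤ`. -/
local instance haarUnitAddCircle : MeasureSpace UnitAddCircle := ⟨AddCircle.haarAddCircle⟩

local instance : IsProbabilityMeasure (volume : Measure UnitAddCircle) :=
  inferInstanceAs (IsProbabilityMeasure AddCircle.haarAddCircle)

open UnitAddTorus

variable {d : ℕ}

/-- The character `t ↦ exp(2πi t·k)`. -/
def cubeChar (k : Fin d → ℤ) (t : Fin d → ℝ) : ℂ :=
  Complex.exp (2 * π * Complex.I * ((∑ i, t i * (k i : ℝ) : ℝ) : ℂ))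

/-- The projection `ℝ^d → (ℝ/ℤ)^d`. -/
def toTorus (t : Fin d → ℝ) : UnitAddTorus (Fin d) := fun i => (t i : UnitAddCircle)

/-- The representative in `(0,1]^d`. -/
def fromTorus (θ : UnitAddTorus (Fin d)) : Fin d → ℝ := fun i => (AddCircle.equivIoc 1 0 (θ i)).1

lemma mFourier_toTorus (k : Fin d → ℤ) (t : Fin d → ℝ) :
    mFourier k (toTorus t) = cubeChar k t := by
  simp only [mFourier, toTorus, cubeChar, ContinuousMap.coe_mk, fourier_coe_apply]
  rw [← Complex.exp_sum]
  congr 1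
  push_cast
  rw [Finset.mul_sum]
  refine Finset.sum_congr rfl fun i _ => ?_
  ring

lemma continuous_toTorus : Continuous (toTorus (d := d)) :=
  continuous_pi fun i => (AddCircle.continuous_mk' 1).comp (continuous_apply i)

lemma measurable_fromTorus : Measurable (fromTorus (d := d)) :=
  measurable_pi_lambda _ fun i => measurable_subtype_coe.comp
    ((AddCircle.measurableEquivIoc 1 0).measurable.comp (measurable_pi_apply i))

lemma fromTorus_toTorus {t : Fin d → ℝ} (ht : ∀ i, t i ∈ Set.Ioc (0 : ℝ) (0 + 1)) :
    fromTorus (toTorus t) = t := by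
  ext i
  have := AddCircle.equivIoc_coe_of_mem (p := 1) (a := 0) (ht i)
  simp only [fromTorus, toTorus, this]

/-- The half-open cube is the fundamental domain for the torus; its difference from the closed cube
is null. -/
lemma restrict_cube_eq : (volume : Measure (Fin d → ℝ)).restrict
      {x : Fin d → ℝ | ∀ i, x i ∈ Set.Ioc ((0 : Fin d → ℝ) i) ((0 : Fin d → ℝ) i + 1)}
    = volume.restrict (Set.Icc (0 : Fin d → ℝ) 1) := by
  refine Measure.restrict_congr_set ?_
  have h := Measure.univ_pi_Ioc_ae_eq_Icc (μ := fun _ : Fin d => (volume : Measure ℝ))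
    (f := 0) (g := 1)
  refine Filter.EventuallyEq.trans (Filter.EventuallyEq.of_eq ?_) h
  ext x
  change (∀ i, _) ↔ (∀ i, _)
  simp

lemma measurableSet_IocCube : MeasurableSet {x : Fin d → ℝ | ∀ i,
    x i ∈ Set.Ioc ((0 : Fin d → ℝ) i) ((0 : Fin d → ℝ) i + 1)} := by
  have : {x : Fin d → ℝ | ∀ i, x i ∈ Set.Ioc ((0 : Fin d → ℝ) i) ((0 : Fin d → ℝ) i + 1)}
    = Set.univ.pi fun i => Set.Ioc ((0 : Fin d → ℝ) i) ((0 : Fin d → ℝ) i + 1) := by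
    ext x; simp
  rw [this]
  exact MeasurableSet.univ_pi fun i => measurableSet_Ioc

lemma ae_cube_fromTorus : ∀ᵐ t ∂(volume.restrict (Set.Icc (0 : Fin d → ℝ) 1)),
    fromTorus (toTorus t) = t := by
  rw [← restrict_cube_eq]
  filter_upwards [ae_restrict_mem measurableSet_IocCube] with t ht
  exact fromTorus_toTorus (by simpa using ht)

lemma measurePreserving_toTorus :
    MeasurePreserving (toTorus (d := d)) (volume.restrict (Set.Icc (0 : Fin d → ℝ) 1)) volume := by
  refine ⟨continuous_toTorus.measurable, ?_⟩
  ext S hS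
  rw [Measure.map_apply continuous_toTorus.measurable hS, ← restrict_cube_eq,
    ← lintegral_indicator_one hS, lintegral_preimage _ (0 : Fin d → ℝ),
    ← lintegral_indicator_one (continuous_toTorus.measurable hS)]
  rfl

lemma measurePreserving_fromTorus :
    MeasurePreserving (fromTorus (d := d)) volume (volume.restrict (Set.Icc (0 : Fin d → ℝ) 1)) := by
  refine ⟨measurable_fromTorus, ?_⟩
  rw [← measurePreserving_toTorus.map_eq, Measure.map_map measurable_fromTorus
    continuous_toTorus.measurable]
  conv_rhs => rw [← Measure.map_id (μ := volume.restrict (Set.Icc (0 : Fin d → ℝ) 1))]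
  refine Measure.map_congr ?_
  filter_upwards [ae_cube_fromTorus] with t ht using ht

lemma cubeFourierCoeff_eq_setIntegral_cubeChar (g : (Fin d → ℝ) → ℂ) (k : Fin d → ℤ) :
    cubeFourierCoeff g k = ∫ t in Set.Icc (0 : Fin d → ℝ) 1, cubeChar (-k) t * g t := by
  unfold cubeFourierCoeff cubeChar
  congr 1
  ext t
  rw [mul_comm]
  congr 2
  simp

lemma mFourierCoeff_fromTorus (g : (Fin d → ℝ) → ℂ) (k : Fin d → ℤ) :
    mFourierCoeff (fun θ => g (fromTorus θ)) k = cubeFourierCoeff g k := by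
  rw [mFourierCoeff_eq_integral _ _ (0 : Fin d → ℝ), cubeFourierCoeff_eq_setIntegral_cubeChar]
  rw [restrict_cube_eq]
  refine integral_congr_ae ?_
  filter_upwards [ae_cube_fromTorus] with t ht
  change mFourier (-k) (toTorus t) • g (fromTorus (toTorus t)) = _
  rw [ht, mFourier_toTorus, smul_eq_mul]

lemma continuous_cubeChar (k : Fin d → ℤ) : Continuous (cubeChar k) := by
  unfold cubeChar; fun_prop

lemma norm_cubeChar (k : Fin d → ℤ) (t : Fin d → ℝ) : ‖cubeChar k t‖ = 1 := by
  unfold cubeChar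
  rw [show (2 * π * Complex.I * ((∑ i, t i * (k i : ℝ) : ℝ) : ℂ))
    = ((2 * π * ∑ i, t i * (k i : ℝ) : ℝ) : ℂ) * Complex.I by push_cast; ring]
  exact Complex.norm_exp_ofReal_mul_I _

lemma memLp_fromTorus {g : (Fin d → ℝ) → ℂ}
    (hg : MemLp g 2 (volume.restrict (Set.Icc (0 : Fin d → ℝ) 1))) :
    MemLp (fun θ : UnitAddTorus (Fin d) => g (fromTorus θ)) 2 volume :=
  hg.comp_measurePreserving measurePreserving_fromTorus

lemma mFourierCoeff_toLp_fromTorus {g : (Fin d → ℝ) → ℂ}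
    (hg : MemLp g 2 (volume.restrict (Set.Icc (0 : Fin d → ℝ) 1))) (k : Fin d → ℤ) :
    mFourierCoeff ((memLp_fromTorus hg).toLp _) k = cubeFourierCoeff g k := by
  rw [← mFourierCoeff_fromTorus]
  unfold mFourierCoeff
  refine integral_congr_ae ?_
  filter_upwards [(memLp_fromTorus hg).coeFn_toLp] with θ hθ
  rw [hθ]

/-- Parseval's identity on the cube. -/
lemma hasSum_sq_cubeFourierCoeff {g : (Fin d → ℝ) → ℂ}
    (hg : MemLp g 2 (volume.restrict (Set.Icc (0 : Fin d → ℝ) 1))) :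
    HasSum (fun k => ‖cubeFourierCoeff g k‖ ^ 2)
      (∫ t in Set.Icc (0 : Fin d → ℝ) 1, ‖g t‖ ^ 2) := by
  have h := hasSum_sq_mFourierCoeff ((memLp_fromTorus hg).toLp _)
  simp only [mFourierCoeff_toLp_fromTorus hg] at h
  convert h using 1
  trans ∫ θ : UnitAddTorus (Fin d), ‖g (fromTorus θ)‖ ^ 2
  · rw [← measurePreserving_fromTorus.map_eq, integral_map measurable_fromTorus.aemeasurable]
    rw [measurePreserving_fromTorus.map_eq]
    exact (hg.1.norm.pow 2)
  · refine integral_congr_ae ?_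
    filter_upwards [(memLp_fromTorus hg).coeFn_toLp] with θ hθ
    rw [hθ]

lemma cubeChar_add_single (k : Fin d → ℤ) (i : Fin d) (t : Fin d → ℝ) :
    cubeChar k (t + Pi.single i 1) = cubeChar k t := by
  rw [← mFourier_toTorus, ← mFourier_toTorus]
  congr 1
  ext j
  by_cases hj : j = i
  · subst hj; simp [toTorus]
  · simp [toTorus, hj]

/-- A square-integrable function with summable Fourier coefficients agrees almost everywhere with
the sum of its Fourier series. -/
lemma tsum_cubeFourierCoeff_ae_eq {g : (Fin d → ℝ) → ℂ}
    (hg : MemLp g 2 (volume.restrict (Set.Icc (0 : Fin d → ℝ) 1)))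
    (hs : Summable fun k => ‖cubeFourierCoeff g k‖) :
    (fun t => ∑' k, cubeFourierCoeff g k * cubeChar k t)
      =ᵐ[volume.restrict (Set.Icc (0 : Fin d → ℝ) 1)] g := by
  have h1 := hasSum_mFourier_series_L2 ((memLp_fromTorus hg).toLp _)
  simp only [mFourierCoeff_toLp_fromTorus hg] at h1
  have hsum : Summable fun k => cubeFourierCoeff g k • (mFourier k : C(UnitAddTorus (Fin d), ℂ)) :=
    Summable.of_norm (by simpa only [norm_smul, mFourier_norm, mul_one] using hs)
  obtain ⟨S, hS⟩ := hsum
  have h2 := (ContinuousMap.toLp (E := ℂ) 2 (volume : Measure (UnitAddTorus (Fin d))) ℂ).hasSum hS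
  simp only [map_smul] at h2
  have h3 := h2.unique h1
  have h4 : (S : UnitAddTorus (Fin d) → ℂ) =ᵐ[volume] fun θ => g (fromTorus θ) := by
    refine (ContinuousMap.coeFn_toLp (𝕜 := ℂ) (p := 2) volume S).symm.trans ?_
    rw [h3]
    exact (memLp_fromTorus hg).coeFn_toLp
  have h5 := measurePreserving_toTorus.quasiMeasurePreserving.ae_eq_comp h4
  filter_upwards [h5, ae_cube_fromTorus] with t ht ht2
  simp only [Function.comp_apply, ht2] at ht
  rw [← ht]
  have h6 := (ContinuousMap.evalCLM ℂ (toTorus t)).hasSum hS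
  simp only [map_smul] at h6
  rw [show S (toTorus t) = ContinuousMap.evalCLM ℂ (toTorus t) S from rfl, ← h6.tsum_eq]
  refine tsum_congr fun k => ?_
  rw [smul_eq_mul, ← mFourier_toTorus]
  rfl

lemma continuous_tsum_cubeChar {a : (Fin d → ℤ) → ℂ} (hs : Summable fun k => ‖a k‖) :
    Continuous fun t => ∑' k, a k * cubeChar k t :=
  continuous_tsum (fun k => continuous_const.mul (continuous_cubeChar k)) hs fun k t => by
    rw [norm_mul, norm_cubeChar, mul_one]

lemma cubeFourierCoeff_cubeChar (h k : Fin d → ℤ) :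
    cubeFourierCoeff (cubeChar h) k = if k = h then 1 else 0 := by
  classical
  have h1 := orthonormal_iff_ite.mp (orthonormal_mFourier (d := Fin d)) k h
  rw [← h1, ContinuousMap.inner_toLp, cubeFourierCoeff_eq_setIntegral_cubeChar,
    ← measurePreserving_toTorus.map_eq, integral_map continuous_toTorus.measurable.aemeasurable]
  · refine integral_congr_ae (Filter.Eventually.of_forall fun t => ?_)
    simp only [mFourier_toTorus]
    rw [← mFourier_toTorus k, ← mFourier_neg, mFourier_toTorus, mul_comm]
  · exact (Continuous.aestronglyMeasurable (by fun_prop))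

end Torus

/-! ### The worst-case error in the Korobov space -/

section KorobovError

variable {d : ℕ}

lemma korobovWeight_pos (α : ℕ) (k : Fin d → ℤ) : 0 < korobovWeight α k :=
  Finset.prod_pos fun _ _ => lt_of_lt_of_le one_pos (le_max_left _ _)

lemma ofReal_korobovWeight_sq_inv (α : ℕ) (k : Fin d → ℤ) :
    ENNReal.ofReal ((korobovWeight α k ^ 2)⁻¹) = ∏ i, hypWeight (2 * α) (k i) := by
  unfold hypWeight korobovWeight
  rw [← ENNReal.ofReal_prod_of_nonneg fun i _ => by positivity, ← Finset.prod_pow,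
    ← Finset.prod_inv_distrib]
  congr 1
  refine Finset.prod_congr rfl fun i _ => ?_
  have h : max 1 (|(k i : ℝ)| ^ α) = (max 1 |(k i : ℝ)|) ^ α := by
    rcases le_total 1 |(k i : ℝ)| with h | h
    · rw [max_eq_right h, max_eq_right (one_le_pow₀ h)]
    · rw [max_eq_left h, max_eq_left (pow_le_one₀ (abs_nonneg _) h), one_pow]
  rw [h, Real.rpow_neg (by positivity), ← pow_mul, ← Real.rpow_natCast]
  congr 2; push_cast; ring

lemma twoZeta_two_mul_lt_top {α : ℕ} (hα : 1 ≤ α) : twoZeta (2 * α) < ⊤ := by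
  have hα' : (1 : ℝ) ≤ α := by exact_mod_cast hα
  have h := twoZeta_le (δ := 2 * α - 1) (by linarith)
  rw [show (1 : ℝ) + (2 * α - 1) = 2 * α by ring] at h
  exact h.trans_lt ENNReal.ofReal_lt_top

lemma tsum_prod_hypWeight_lt_top {α : ℕ} (hα : 1 ≤ α) :
    ∑' k : Fin d → ℤ, ∏ i, hypWeight (2 * α) (k i) < ⊤ := by
  rw [tsum_pi_prod, tsum_hypWeight]
  exact ENNReal.pow_lt_top (ENNReal.add_lt_top.mpr ⟨ENNReal.one_lt_top, twoZeta_two_mul_lt_top hα⟩)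

lemma latSum_lt_top {α : ℕ} (hα : 1 ≤ α) (N : ℕ) (z : Fin d → ℕ) : latSum (2 * α) N z < ⊤ := by
  refine lt_of_le_of_lt (ENNReal.tsum_le_tsum fun k => ?_) (tsum_prod_hypWeight_lt_top (d := d) hα)
  split_ifs
  · exact le_rfl
  · exact zero_le

lemma summable_korobovWeight_sq_inv {α : ℕ} (hα : 1 ≤ α) :
    Summable fun k : Fin d → ℤ => (korobovWeight α k ^ 2)⁻¹ := by
  have h := (tsum_prod_hypWeight_lt_top (d := d) hα).ne
  simp_rw [← ofReal_korobovWeight_sq_inv] at h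
  refine (ENNReal.summable_toReal h).congr fun k => ?_
  exact ENNReal.toReal_ofReal (by positivity)

/-- By the inequality `x y ≤ x² + y²` with `x = ‖a‖ r`, `y = r⁻¹`. The weights `r⁻²` are summable
because `2α > 1`. -/
lemma summable_norm_of_summable_korobov {α : ℕ} (hα : 1 ≤ α) {a : (Fin d → ℤ) → ℂ}
    (ha : Summable fun k => ‖a k‖ ^ 2 * korobovWeight α k ^ 2) : Summable fun k => ‖a k‖ := by
  refine Summable.of_nonneg_of_le (fun k => norm_nonneg _) (fun k => ?_)
    (ha.add (summable_korobovWeight_sq_inv hα))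
  have hr := korobovWeight_pos α k
  have h1 : (korobovWeight α k ^ 2)⁻¹ = ((korobovWeight α k)⁻¹) ^ 2 := by rw [inv_pow]
  have h2 : ‖a k‖ = (‖a k‖ * korobovWeight α k) * (korobovWeight α k)⁻¹ := by field_simp
  rw [h1, ← mul_pow]
  nlinarith [sq_nonneg (‖a k‖ * korobovWeight α k - (korobovWeight α k)⁻¹),
    sq_nonneg (‖a k‖ * korobovWeight α k + (korobovWeight α k)⁻¹),
    sq_nonneg (‖a k‖ * korobovWeight α k), norm_nonneg (a k)]

/-! ### Lattice rules acting on Fourier series -/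

/-- The rank-1 lattice rule. -/
def latticeRule (N : ℕ) (z : Fin d → ℕ) (g : (Fin d → ℝ) → ℂ) : ℂ :=
  (1 / N : ℂ) * ∑ j ∈ Finset.Icc 1 N, g (latticePoint N z j)

/-- Taking fractional parts shifts the exponent by an integer multiple of `2πi`, so the values along
the lattice are powers of one `N`-th root of unity. -/
lemma cubeChar_latticePoint (N : ℕ) (z : Fin d → ℕ) (k : Fin d → ℤ) (j : ℕ) :
    cubeChar k (latticePoint N z j)
      = Complex.exp (2 * π * Complex.I * ((∑ i, k i * z i : ℤ) : ℂ) / N) ^ j := by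
  rw [← Complex.exp_nat_mul]
  unfold cubeChar latticePoint
  rw [Complex.exp_eq_exp_iff_exists_int]
  refine ⟨-∑ i, ⌊(z i : ℝ) * j / N⌋ * k i, ?_⟩
  simp only [Int.fract]
  push_cast
  simp only [sub_mul, Finset.sum_sub_distrib, mul_sub, neg_mul]
  rw [sub_eq_add_neg]
  congr 1
  · rw [Finset.mul_sum, Finset.mul_sum, Finset.sum_div, Finset.mul_sum]
    refine Finset.sum_congr rfl fun i _ => ?_
    ring
  · ring

open Classical in
lemma latticeRule_cubeChar {N : ℕ} (hN : N ≠ 0) (z : Fin d → ℕ) (k : Fin d → ℤ) :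
    latticeRule N z (cubeChar k) = if (N : ℤ) ∣ ∑ i, k i * z i then 1 else 0 := by
  have hNC : (N : ℂ) ≠ 0 := by exact_mod_cast hN
  unfold latticeRule
  simp_rw [cubeChar_latticePoint]
  set m : ℤ := ∑ i, k i * z i with hm
  set ζ := Complex.exp (2 * π * Complex.I * (m : ℂ) / N) with hζ
  have hζN : ζ ^ N = 1 := by
    rw [hζ, ← Complex.exp_nat_mul, Complex.exp_eq_one_iff]
    exact ⟨m, by field_simp⟩
  split_ifs with hd
  · obtain ⟨c, hc⟩ := hd
    have h1 : ζ = 1 := by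
      rw [hζ, hc, Complex.exp_eq_one_iff]
      exact ⟨c, by push_cast; field_simp⟩
    rw [h1]; simp [hNC]
  · have h1 : ζ ≠ 1 := by
      intro h
      rw [hζ, Complex.exp_eq_one_iff] at h
      obtain ⟨n, hn⟩ := h
      apply hd
      refine ⟨n, ?_⟩
      have hpi : (2 * π * Complex.I : ℂ) ≠ 0 := Complex.two_pi_I_ne_zero
      have : (m : ℂ) = N * n := by
        field_simp at hn
        exact hn
      exact_mod_cast this
    have h2 : ∑ j ∈ Finset.Icc 1 N, ζ ^ j = ζ * ∑ j ∈ Finset.range N, ζ ^ j := by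
      rw [Finset.mul_sum, Finset.range_eq_Ico, Finset.sum_Ico_eq_sum_range,
        ← Finset.Ico_add_one_right_eq_Icc, Finset.sum_Ico_eq_sum_range]
      refine Finset.sum_congr (by simp) fun j _ => ?_
      rw [zero_add, pow_add, pow_one]
    rw [h2, geom_sum_eq h1, hζN]; simp

lemma integral_cubeChar (k : Fin d → ℤ) :
    ∫ t in Set.Icc (0 : Fin d → ℝ) 1, cubeChar k t = if k = 0 then 1 else 0 := by
  have h := cubeFourierCoeff_cubeChar k 0
  rw [cubeFourierCoeff_eq_setIntegral_cubeChar] at h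
  simp only [neg_zero] at h
  have e : ∀ t : Fin d → ℝ, cubeChar (0 : Fin d → ℤ) t = 1 := fun t => by simp [cubeChar]
  simp only [e, one_mul] at h
  rw [h]
  exact if_congr eq_comm rfl rfl

lemma integral_tsum_cubeChar {a : (Fin d → ℤ) → ℂ} (hs : Summable fun k => ‖a k‖) :
    ∫ t in Set.Icc (0 : Fin d → ℝ) 1, ∑' k, a k * cubeChar k t = a 0 := by
  have hfin : IsFiniteMeasure ((volume : Measure (Fin d → ℝ)).restrict (Set.Icc 0 1)) :=
    ⟨by rw [Measure.restrict_apply_univ]; exact isCompact_Icc.measure_lt_top⟩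
  have hvol : ((volume : Measure (Fin d → ℝ)).restrict (Set.Icc 0 1)).real Set.univ = 1 := by
    have h := integral_cubeChar (0 : Fin d → ℤ)
    have e : ∀ t : Fin d → ℝ, cubeChar (0 : Fin d → ℤ) t = 1 := fun t => by simp [cubeChar]
    simp only [e, integral_const, if_true] at h
    simpa using h
  rw [← integral_tsum_of_summable_integral_norm]
  · simp_rw [integral_const_mul, integral_cubeChar]
    rw [tsum_eq_single 0 fun k hk => by simp [hk]]
    simp
  · intro k
    refine Integrable.const_mul ?_ _
    exact ((continuous_cubeChar k).continuousOn.integrableOn_compact isCompact_Icc)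
  · simp_rw [norm_mul, norm_cubeChar, mul_one, integral_const, hvol, one_smul]
    exact hs

/-- The cube is the closure of its interior, so an almost everywhere identity between continuous
functions holds at every point, faces included. -/
lemma continuousOn_eq_on_cube {E : Type*} [TopologicalSpace E] [T2Space E]
    {G H : (Fin d → ℝ) → E} (hG : ContinuousOn G (Set.Icc 0 1)) (hH : ContinuousOn H (Set.Icc 0 1))
    (h : G =ᵐ[volume.restrict (Set.Icc (0 : Fin d → ℝ) 1)] H) :
    Set.EqOn G H (Set.Icc 0 1) := by
  refine Measure.eqOn_of_ae_eq h hG hH ?_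
  rw [← Set.pi_univ_Icc, interior_pi_set Set.finite_univ, closure_pi_set]
  refine Set.pi_mono fun i _ => ?_
  simp [interior_Icc, closure_Ioo]

lemma latticePoint_mem (N : ℕ) (z : Fin d → ℕ) (j : ℕ) : latticePoint N z j ∈ Set.Icc 0 1 :=
  ⟨fun _ => Int.fract_nonneg _, fun _ => (Int.fract_lt_one _).le⟩

open Classical in
/-- The error of the lattice rule, in terms of the Fourier coefficients. -/
lemma integral_sub_latticeRule {N : ℕ} (hN : N ≠ 0) (z : Fin d → ℕ) {a : (Fin d → ℤ) → ℂ}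
    (hs : Summable fun k => ‖a k‖) :
    (∫ t in Set.Icc (0 : Fin d → ℝ) 1, ∑' k, a k * cubeChar k t)
      - latticeRule N z (fun t => ∑' k, a k * cubeChar k t)
      = -∑' k, if k ≠ 0 ∧ (N : ℤ) ∣ ∑ i, k i * z i then a k else 0 := by
  have hsum : ∀ t, Summable fun k => a k * cubeChar k t := fun t =>
    Summable.of_norm (by simpa only [norm_mul, norm_cubeChar, mul_one] using hs)
  have e1 : latticeRule N z (fun t => ∑' k, a k * cubeChar k t)
      = ∑' k, if (N : ℤ) ∣ ∑ i, k i * z i then a k else 0 := by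
    unfold latticeRule
    rw [← Summable.tsum_finsetSum fun j _ => hsum _, ← tsum_mul_left]
    refine tsum_congr fun k => ?_
    rw [← Finset.mul_sum]
    have := latticeRule_cubeChar hN z k
    unfold latticeRule at this
    rw [mul_left_comm, this]
    split_ifs <;> simp
  have hs' : Summable fun k => if (N : ℤ) ∣ ∑ i, k i * z i then a k else 0 := by
    refine Summable.of_norm_bounded hs fun k => ?_
    split_ifs <;> simp
  rw [e1, integral_tsum_cubeChar hs, hs'.tsum_eq_add_tsum_ite 0]
  simp only [Pi.zero_apply, zero_mul, Finset.sum_const_zero, dvd_zero, if_true, sub_add_cancel_left]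
  congr 1
  refine tsum_congr fun k => ?_
  by_cases hk : k = 0 <;> simp [hk]

/-- The error of the lattice rule is at most the Korobov norm times the square root of `latSum`. -/
lemma norm_integral_sub_latticeRule_le {α N : ℕ} (hα : 1 ≤ α) (hN : N ≠ 0) (z : Fin d → ℕ)
    {a : (Fin d → ℤ) → ℂ} (ha : Summable fun k => ‖a k‖ ^ 2 * korobovWeight α k ^ 2) :
    ‖(∫ t in Set.Icc (0 : Fin d → ℝ) 1, ∑' k, a k * cubeChar k t)
      - latticeRule N z (fun t => ∑' k, a k * cubeChar k t)‖
      ≤ √(∑' k, ‖a k‖ ^ 2 * korobovWeight α k ^ 2) * √(latSum (2 * α) N z).toReal := by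
  classical
  rw [integral_sub_latticeRule hN z (summable_norm_of_summable_korobov hα ha), norm_neg]
  set L : Set (Fin d → ℤ) := {k | k ≠ 0 ∧ (N : ℤ) ∣ ∑ i, k i * z i} with hL
  have hlat : (latSum (2 * α) N z).toReal
      = ∑' k, (if k ∈ L then (korobovWeight α k)⁻¹ else 0) ^ (2 : ℝ) := by
    unfold latSum
    rw [ENNReal.tsum_toReal_eq]
    · refine tsum_congr fun k => ?_
      by_cases hk : k ≠ 0 ∧ (N : ℤ) ∣ ∑ i, k i * z i
      · rw [if_pos hk, if_pos (show k ∈ L from hk), ← ofReal_korobovWeight_sq_inv,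
          ENNReal.toReal_ofReal (by positivity)]
        rw [Real.rpow_two, inv_pow]
      · rw [if_neg hk, if_neg (show k ∉ L from hk)]
        simp
    · intro k
      exact ENNReal.ne_top_of_tsum_ne_top (latSum_lt_top hα N z).ne k
  have hsq : Summable fun k => (if k ∈ L then (korobovWeight α k)⁻¹ else 0) ^ (2 : ℝ) := by
    refine Summable.of_nonneg_of_le (fun k => Real.rpow_nonneg ?_ _) (fun k => ?_)
      (summable_korobovWeight_sq_inv (d := d) hα)
    · split_ifs; exacts [(inv_pos.mpr (korobovWeight_pos α k)).le, le_rfl]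
    split_ifs
    · rw [Real.rpow_two, inv_pow]
    · simp; positivity
  have ha' : Summable fun k => (‖a k‖ * korobovWeight α k) ^ (2 : ℝ) := by
    refine ha.congr fun k => ?_
    rw [Real.rpow_two, mul_pow]
  have hr : ∀ k : Fin d → ℤ, 0 < korobovWeight α k := korobovWeight_pos α
  have hnn : ∀ k, 0 ≤ (if k ∈ L then (korobovWeight α k)⁻¹ else 0) := fun k => by
    split_ifs; exacts [inv_nonneg.mpr (hr k).le, le_rfl]
  obtain ⟨hsm, h1⟩ := Real.summable_and_inner_le_Lp_mul_Lq_tsum_of_nonneg (p := 2) (q := 2)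
    Real.HolderConjugate.two_two (fun k => mul_nonneg (norm_nonneg (a k)) (hr k).le) hnn ha' hsq
  have e : ∀ k, ‖if k ≠ 0 ∧ (N : ℤ) ∣ ∑ i, k i * z i then a k else 0‖
      = ‖a k‖ * korobovWeight α k * (if k ∈ L then (korobovWeight α k)⁻¹ else 0) := by
    intro k
    by_cases hk : k ≠ 0 ∧ (N : ℤ) ∣ ∑ i, k i * z i
    · rw [if_pos hk, if_pos (show k ∈ L from hk), mul_assoc, mul_inv_cancel₀ (hr k).ne', mul_one]
    · rw [if_neg hk, if_neg (show k ∉ L from hk)]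
      simp
  refine (norm_tsum_le_tsum_norm (hsm.congr fun k => (e k).symm)).trans ?_
  simp_rw [e]
  refine h1.trans (le_of_eq ?_)
  rw [hlat, Real.sqrt_eq_rpow, Real.sqrt_eq_rpow]
  congr 2
  exact tsum_congr fun k => by rw [Real.rpow_two, mul_pow]

/-! ### The Korobov worst-case error as a dual lattice sum -/

lemma korobovWorstCaseError_sq_le {α N : ℕ} (hα : 1 ≤ α) (hN : N ≠ 0) (z : Fin d → ℕ) :
    korobovWorstCaseError α N z ^ 2 ≤ latSum (2 * α) N z := by
  have hL := latSum_lt_top hα N z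
  have h1 : korobovWorstCaseError α N z ≤ ENNReal.ofReal (√(latSum (2 * α) N z).toReal) := by
    refine iSup_le fun g => iSup_le fun hg => iSup_le fun _ => iSup_le fun hK => iSup_le fun hn => ?_
    apply ENNReal.ofReal_le_ofReal
    have hs := summable_norm_of_summable_korobov hα hK.2
    have hae := tsum_cubeFourierCoeff_ae_eq hK.1 hs
    have heq := continuousOn_eq_on_cube (continuous_tsum_cubeChar hs).continuousOn hg.continuousOn hae
    have h2 := norm_integral_sub_latticeRule_le hα hN z hK.2
    have h3 : latticeRule N z (fun t => ∑' k, cubeFourierCoeff g k * cubeChar k t)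
        = latticeRule N z g := by
      unfold latticeRule
      congr 1
      exact Finset.sum_congr rfl fun j _ => heq (latticePoint_mem N z j)
    rw [integral_congr_ae hae, h3] at h2
    refine h2.trans ?_
    exact mul_le_of_le_one_left (Real.sqrt_nonneg _) hn
  calc _ ≤ ENNReal.ofReal (√(latSum (2 * α) N z).toReal) ^ 2 := by gcongr
    _ = latSum (2 * α) N z := by
      rw [← ENNReal.ofReal_pow (Real.sqrt_nonneg _), Real.sq_sqrt ENNReal.toReal_nonneg,
        ENNReal.ofReal_toReal hL.ne]

lemma memLp_cube_of_continuous {g : (Fin d → ℝ) → ℂ} (hg : Continuous g) :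
    MemLp g 2 (volume.restrict (Set.Icc (0 : Fin d → ℝ) 1)) :=
by
  have hfin : IsFiniteMeasure ((volume : Measure (Fin d → ℝ)).restrict (Set.Icc 0 1)) :=
    ⟨by rw [Measure.restrict_apply_univ]; exact isCompact_Icc.measure_lt_top⟩
  obtain ⟨C, hC⟩ := (isCompact_Icc (a := (0 : Fin d → ℝ)) (b := 1)).exists_bound_of_continuousOn
    hg.continuousOn
  exact MemLp.of_bound hg.aestronglyMeasurable C
    ((ae_restrict_mem measurableSet_Icc).mono fun t ht => hC t ht)

lemma integrableOn_cubeChar (k : Fin d → ℤ) (c : ℂ) :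
    IntegrableOn (fun t => c * cubeChar k t) (Set.Icc (0 : Fin d → ℝ) 1) :=
  (continuous_const.mul (continuous_cubeChar k)).continuousOn.integrableOn_compact isCompact_Icc

/-- The equality case of Cauchy–Schwarz. On a finite part `F` of the nonzero dual lattice, the
trigonometric polynomial with coefficients proportional to `r⁻²` has error equal to the square root
of the partial sum; finite sets suffice since `latSum` is their supremum. -/
lemma latSum_le_korobovWorstCaseError_sq {α N : ℕ} (hN : N ≠ 0) (z : Fin d → ℕ) :
    latSum (2 * α) N z ≤ korobovWorstCaseError α N z ^ 2 := by
  classical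
  unfold latSum
  rw [ENNReal.tsum_eq_iSup_sum]
  refine iSup_le fun F₀ => ?_
  rw [← Finset.sum_filter]
  set F := F₀.filter fun k : Fin d → ℤ => k ≠ 0 ∧ (N : ℤ) ∣ ∑ i, k i * z i with hF
  have hFk : ∀ k ∈ F, k ≠ 0 ∧ (N : ℤ) ∣ ∑ i, k i * z i := fun k hk => (Finset.mem_filter.mp hk).2
  simp_rw [← ofReal_korobovWeight_sq_inv]
  rw [← ENNReal.ofReal_sum_of_nonneg fun k _ => by positivity]
  set w : (Fin d → ℤ) → ℝ := fun k => (korobovWeight α k ^ 2)⁻¹ with hw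
  have hr : ∀ k : Fin d → ℤ, 0 < korobovWeight α k := korobovWeight_pos α
  have hw0 : ∀ k, 0 ≤ w k := fun k => by positivity
  set S := ∑ k ∈ F, w k with hS
  rcases (Finset.sum_nonneg fun k (_ : k ∈ F) => hw0 k).eq_or_lt with hS0 | hS0
  · rw [← hS] at hS0
    rw [← hS0, ENNReal.ofReal_zero]; exact zero_le
  rw [← hS] at hS0
  -- The normalization that makes the Korobov norm of `g` equal to `1`.
  set c := (√S)⁻¹ with hc
  have hcS : c ^ 2 * S = 1 := by
    rw [hc, inv_pow, Real.sq_sqrt hS0.le, inv_mul_cancel₀ hS0.ne']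
  have hc0 : 0 ≤ c := by positivity
  set a : (Fin d → ℤ) → ℂ := fun k => if k ∈ F then ((c * w k : ℝ) : ℂ) else 0 with ha
  set g : (Fin d → ℝ) → ℂ := fun t => ∑ k ∈ F, a k * cubeChar k t with hg
  have hgc : Continuous g := continuous_finsetSum _ fun k _ =>
    continuous_const.mul (continuous_cubeChar k)
  have hcoef : ∀ k, cubeFourierCoeff g k = a k := by
    intro k
    rw [cubeFourierCoeff_eq_setIntegral_cubeChar]
    simp only [hg, Finset.mul_sum]
    rw [integral_finsetSum]
    · have e : ∀ m ∈ F, ∫ t in Set.Icc (0 : Fin d → ℝ) 1, cubeChar (-k) t * (a m * cubeChar m t)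
          = a m * if k = m then 1 else 0 := by
        intro m _
        rw [← cubeFourierCoeff_cubeChar, cubeFourierCoeff_eq_setIntegral_cubeChar,
          ← integral_const_mul]
        congr 1; ext t; ring
      rw [Finset.sum_congr rfl e]
      simp only [mul_ite, mul_one, mul_zero, Finset.sum_ite_eq]
      simp only [ha]
      split_ifs <;> rfl
    · intro m _
      exact ((continuous_cubeChar _).mul (continuous_const.mul
        (continuous_cubeChar m))).continuousOn.integrableOn_compact isCompact_Icc
  have hterm : ∀ k, ‖a k‖ ^ 2 * korobovWeight α k ^ 2 = if k ∈ F then c ^ 2 * w k else 0 := by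
    intro k
    simp only [ha]
    split_ifs
    · rw [Complex.norm_real, Real.norm_of_nonneg (mul_nonneg hc0 (hw0 k)), hw]
      have := (hr k).ne'
      field_simp
    · simp
  have hnorm : HasSum (fun k => ‖cubeFourierCoeff g k‖ ^ 2 * korobovWeight α k ^ 2) 1 := by
    simp_rw [hcoef, hterm]
    have := hasSum_sum_of_ne_finset_zero (L := SummationFilter.unconditional _) (f := fun k => if k ∈ F then c ^ 2 * w k else 0) (s := F)
      (fun k hk => if_neg hk)
    convert this using 1
    rw [Finset.sum_congr rfl fun k hk => if_pos hk, ← Finset.mul_sum, hcS]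
  have herr : ‖(∫ t in Set.Icc (0 : Fin d → ℝ) 1, g t) -
      (1 / N : ℂ) * ∑ j ∈ Finset.Icc 1 N, g (latticePoint N z j)‖ = √S := by
    have e1 : ∫ t in Set.Icc (0 : Fin d → ℝ) 1, g t = 0 := by
      simp only [hg]
      rw [integral_finsetSum _ fun m _ => integrableOn_cubeChar m _]
      refine Finset.sum_eq_zero fun k hk => ?_
      rw [integral_const_mul, integral_cubeChar, if_neg (hFk k hk).1, mul_zero]
    have e2 : (1 / N : ℂ) * ∑ j ∈ Finset.Icc 1 N, g (latticePoint N z j) = ((c * S : ℝ) : ℂ) := by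
      simp only [hg]
      rw [Finset.sum_comm, Finset.mul_sum, hS, Finset.mul_sum, Complex.ofReal_sum]
      refine Finset.sum_congr rfl fun k hk => ?_
      have h1 := latticeRule_cubeChar hN z k
      rw [if_pos (hFk k hk).2] at h1
      unfold latticeRule at h1
      rw [← Finset.mul_sum, mul_left_comm, h1, mul_one]
      simp only [ha, if_pos hk]
    rw [e1, e2, zero_sub, norm_neg, Complex.norm_real, Real.norm_of_nonneg (by positivity), hc]
    rw [inv_mul_eq_div, Real.div_sqrt]
  have hle : ENNReal.ofReal (√S) ≤ korobovWorstCaseError α N z := by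
    rw [← herr]
    unfold korobovWorstCaseError
    refine le_iSup_of_le g (le_iSup_of_le hgc (le_iSup_of_le ?_ (le_iSup_of_le
      ⟨memLp_cube_of_continuous hgc, hnorm.summable⟩ (le_iSup_of_le ?_ le_rfl))))
    · intro i t
      simp only [hg, cubeChar_add_single]
    · unfold korobovNorm
      rw [hnorm.tsum_eq, Real.sqrt_one]
  calc ENNReal.ofReal S = ENNReal.ofReal (√S) ^ 2 := by
        rw [← ENNReal.ofReal_pow (Real.sqrt_nonneg _), Real.sq_sqrt hS0.le]
    _ ≤ _ := by gcongr

/-! ### The component-by-component construction -/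

lemma exists_isCBC (α : ℕ) {N : ℕ} (hN : 2 ≤ N) : ∃ z : Fin d → ℕ, IsCBC α N z := by
  classical
  have hcand : ∀ {n : ℕ} (z : Fin n → ℕ), ∃ w, IsCandidate N w ∧ ∀ w', IsCandidate N w' →
      korobovWorstCaseError α N (Fin.snoc (α := fun _ => ℕ) z w : Fin (n + 1) → ℕ)
        ≤ korobovWorstCaseError α N (Fin.snoc (α := fun _ => ℕ) z w' : Fin (n + 1) → ℕ) := by
    intro n z
    obtain ⟨w, hw, hmin⟩ := Finset.exists_min_image
      ((Finset.range N).filter fun w => IsCandidate N w)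
      (fun w => korobovWorstCaseError α N (Fin.snoc (α := fun _ => ℕ) z w : Fin (n + 1) → ℕ))
      ⟨1, Finset.mem_filter.mpr ⟨Finset.mem_range.mpr (by omega), le_rfl, by omega,
        Nat.coprime_one_left N⟩⟩
    exact ⟨w, (Finset.mem_filter.mp hw).2, fun w' hw' => hmin w'
      (Finset.mem_filter.mpr ⟨Finset.mem_range.mpr hw'.2.1, hw'⟩)⟩
  induction d with
  | zero => exact ⟨Fin.elim0, fun j => j.elim0⟩
  | succ n ih =>
    obtain ⟨z, hz⟩ := ih
    have hpre : ∀ (w : ℕ) (j : Fin n) (v : ℕ),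
        extendPrefix (Fin.snoc (α := fun _ => ℕ) z w : Fin (n + 1) → ℕ) j.castSucc v
          = extendPrefix z j v := by
      intro w j v
      unfold extendPrefix
      congr 1
      ext i
      exact Fin.snoc_castSucc (α := fun _ => ℕ) w z ⟨i, i.isLt.trans j.isLt⟩
    have hlast : ∀ w v : ℕ,
        extendPrefix (Fin.snoc (α := fun _ => ℕ) z w : Fin (n + 1) → ℕ) (Fin.last n) v
          = (Fin.snoc (α := fun _ => ℕ) z v : Fin (n + 1) → ℕ) := by
      intro w v
      unfold extendPrefix
      congr 1
      ext i
      exact Fin.snoc_castSucc (α := fun _ => ℕ) w z i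
    obtain ⟨w₀, hw₀, hmin⟩ := hcand z
    -- The first component is prescribed; only later ones are minimizers. Extending `z` leaves the
    -- earlier conditions intact, as these see only prefixes.
    refine ⟨Fin.snoc (α := fun _ => ℕ) z (if n = 0 then 1 else w₀), fun j => ?_⟩
    refine Fin.lastCases ?_ (fun j => ?_) j
    · simp only [Fin.snoc_last, hlast, Fin.val_last]
      refine ⟨fun h => if_pos h, fun h => ?_⟩
      rw [if_neg h]
      exact ⟨hw₀, hmin⟩
    · simp only [Fin.snoc_castSucc, hpre, Fin.val_castSucc]
      exact hz j

/-- The first `n` components of `z`. -/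
def vecPrefix (z : Fin d → ℕ) (n : ℕ) (hn : n ≤ d) : Fin n → ℕ := fun i => z (i.castLE hn)

/-- Induction on the number of components: each new one adds at most the mean bound `B`, whence the
factor `d`. -/
lemma latSum_isCBC_le {α N : ℕ} (hα : 1 ≤ α) (hN : 2 ≤ N) {z : Fin d → ℕ} (hz : IsCBC α N z) :
    latSum (2 * α) N z ≤ ENNReal.ofReal (d * (10 ^ (2 * α * d) * Real.exp (4 * α) *
        (((N : ℝ) ^ α)⁻¹ * Real.log N ^ (d * α)) ^ 2)) := by
  have hN0 : N ≠ 0 := by omega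
  set B := 10 ^ (2 * α * d) * Real.exp (4 * α) *
        (((N : ℝ) ^ α)⁻¹ * Real.log N ^ (d * α)) ^ 2 with hB
  have hB0 : 0 ≤ B := by positivity
  suffices h : ∀ n (hn : n ≤ d), latSum (2 * α) N (vecPrefix z n hn) ≤ ENNReal.ofReal (n * B) from
    h d le_rfl
  intro n
  induction n with
  | zero => intro hn; rw [latSum_zero_dim]; exact zero_le
  | succ n ih =>
    intro hn
    set j : Fin d := ⟨n, hn⟩ with hj
    have hext : ∀ w, extendPrefix z j w
        = (Fin.snoc (α := fun _ => ℕ) (vecPrefix z n (by omega)) w : Fin (n + 1) → ℕ) :=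
      fun w => rfl
    have hsucc : vecPrefix z (n + 1) hn
        = (Fin.snoc (α := fun _ => ℕ) (vecPrefix z n (by omega)) (z j) : Fin (n + 1) → ℕ) := by
      ext i
      refine Fin.lastCases ?_ (fun i => ?_) i
      · rw [Fin.snoc_last]; rfl
      · rw [Fin.snoc_castSucc]; rfl
    have hfin : latSum (2 * α) N (vecPrefix z n (by omega : n ≤ d)) ≠ ⊤ := (latSum_lt_top hα _ _).ne
    obtain ⟨u, hu⟩ := exists_unit_latLast_two_mul_le hα hn hN (vecPrefix z n (by omega : n ≤ d))
    rw [← hB] at hu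
    have hlast : latLast (2 * α) N (vecPrefix z n (by omega : n ≤ d)) (z j) ≤ ENNReal.ofReal B := by
      rcases Nat.eq_zero_or_pos n with rfl | hn0
      · rw [(hz j).1 rfl, ← latLast_dim_zero _ (isCandidate_unit hN u).2.2]
        exact hu
      · refine le_trans ?_ hu
        have h1 := ((hz j).2 (by simp only [hj]; omega)).2 _ (isCandidate_unit hN u)
        -- CBC optimality is stated for the worst-case error; the two inequalities between its
        -- square and `latSum` turn it into a comparison of dual lattice sums.
        have h2 := (latSum_le_korobovWorstCaseError_sq (α := α) hN0 _).trans
          ((pow_le_pow_left' h1 2).trans (korobovWorstCaseError_sq_le hα hN0 _))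
        rw [hext, hext, latSum_snoc, latSum_snoc] at h2
        exact (ENNReal.add_le_add_iff_left hfin).mp h2
    rw [hsucc, latSum_snoc]
    calc _ ≤ ENNReal.ofReal (n * B) + ENNReal.ofReal B := add_le_add (ih _) hlast
      _ = _ := by
        rw [← ENNReal.ofReal_add (by positivity) hB0]
        congr 1; push_cast; ring

end KorobovError

/-! ### The cotangent transform -/

section CotTransform

variable {d : ℕ}

lemma cotMap_eq_tan (t : ℝ) : cotMap t = Real.tan (π * (t - 1 / 2)) := by
  rw [show π * (t - 1 / 2) = π * t - π / 2 by ring, Real.tan_eq_sin_div_cos,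
    Real.sin_sub_pi_div_two, Real.cos_sub_pi_div_two, cotMap, Real.cot_eq_cos_div_sin, neg_div]

/-- The inverse of the cotangent transform. -/
def arcMap (x : ℝ) : ℝ := 1 / 2 + Real.arctan x / π

lemma arcMap_mem (x : ℝ) : arcMap x ∈ Set.Ioo (0 : ℝ) 1 := by
  have h1 := Real.neg_pi_div_two_lt_arctan x
  have h2 := Real.arctan_lt_pi_div_two x
  have hpi := Real.pi_pos
  have h3 : -(1 / 2) < Real.arctan x / π := by rw [lt_div_iff₀ hpi]; linarith
  have h4 : Real.arctan x / π < 1 / 2 := by rw [div_lt_iff₀ hpi]; linarith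
  constructor <;> unfold arcMap <;> linarith

lemma cotMap_arcMap (x : ℝ) : cotMap (arcMap x) = x := by
  rw [cotMap_eq_tan, arcMap, add_sub_cancel_left, mul_div_cancel₀ _ Real.pi_ne_zero,
    Real.tan_arctan]

lemma arg_mem {t : ℝ} (ht : t ∈ Set.Ioo (0 : ℝ) 1) :
    -(π / 2) < π * (t - 1 / 2) ∧ π * (t - 1 / 2) < π / 2 := by
  have hpi := Real.pi_pos
  constructor <;> nlinarith [ht.1, ht.2]

lemma arcMap_cotMap {t : ℝ} (ht : t ∈ Set.Ioo (0 : ℝ) 1) : arcMap (cotMap t) = t := by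
  rw [cotMap_eq_tan, arcMap, Real.arctan_tan (arg_mem ht).1 (arg_mem ht).2,
    mul_div_cancel_left₀ _ Real.pi_ne_zero]
  ring

lemma hasDerivAt_cotMap {t : ℝ} (ht : t ∈ Set.Ioo (0 : ℝ) 1) :
    HasDerivAt cotMap (π * (1 + cotMap t ^ 2)) t := by
  have hc : 0 < Real.cos (π * (t - 1 / 2)) :=
    Real.cos_pos_of_mem_Ioo ⟨(arg_mem ht).1, (arg_mem ht).2⟩
  have h := (Real.hasDerivAt_tan hc.ne').comp t
    (((hasDerivAt_id t).sub_const (1 / 2)).const_mul π)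
  have e : cotMap = Real.tan ∘ fun t => π * (id t - 1 / 2) := by
    ext t; exact cotMap_eq_tan t
  rw [← e] at h
  refine h.congr_deriv ?_
  rw [cotMap_eq_tan, Real.tan_eq_sin_div_cos]
  have := Real.sin_sq_add_cos_sq (π * (t - 1 / 2))
  generalize π * (t - 1 / 2) = x at *
  field_simp
  linarith

lemma deriv_cotMap {t : ℝ} (ht : t ∈ Set.Ioo (0 : ℝ) 1) :
    deriv cotMap t = π * (1 + cotMap t ^ 2) := (hasDerivAt_cotMap ht).deriv

/-- Used to split a factor vanishing on the boundary off the transformed integrand. -/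
lemma one_add_cotMap_sq {t : ℝ} (ht : t ∈ Set.Ioo (0 : ℝ) 1) :
    (1 + cotMap t ^ 2) * Real.sin (π * t) ^ 2 = 1 := by
  have hs : 0 < Real.sin (π * t) := Real.sin_pos_of_pos_of_lt_pi
    (mul_pos Real.pi_pos ht.1) (by nlinarith [ht.2, Real.pi_pos])
  rw [cotMap, Real.cot_eq_cos_div_sin]
  have := Real.sin_sq_add_cos_sq (π * t)
  field_simp
  linarith

/-- The componentwise cotangent transform. -/
def cotVec (t : Fin d → ℝ) : Fin d → ℝ := fun k => cotMap (t k)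

/-- The componentwise inverse of the cotangent transform. -/
def arcVec (x : Fin d → ℝ) : Fin d → ℝ := fun k => arcMap (x k)

/-- The open unit cube. -/
def openCube (d : ℕ) : Set (Fin d → ℝ) := Set.univ.pi fun _ => Set.Ioo (0 : ℝ) 1

lemma mem_openCube {t : Fin d → ℝ} : t ∈ openCube d ↔ ∀ k, t k ∈ Set.Ioo (0 : ℝ) 1 := by
  simp [openCube]

lemma isOpen_openCube : IsOpen (openCube d) :=
  isOpen_set_pi Set.finite_univ fun _ _ => isOpen_Ioo

lemma openCube_subset : openCube d ⊆ Set.Icc 0 1 := fun _ ht =>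
  ⟨fun k => (mem_openCube.mp ht k).1.le, fun k => (mem_openCube.mp ht k).2.le⟩

lemma arcVec_mem (x : Fin d → ℝ) : arcVec x ∈ openCube d := mem_openCube.mpr fun _ => arcMap_mem _

lemma cotVec_arcVec (x : Fin d → ℝ) : cotVec (arcVec x) = x := by
  ext k; exact cotMap_arcMap _

lemma arcVec_cotVec {t : Fin d → ℝ} (ht : t ∈ openCube d) : arcVec (cotVec t) = t := by
  ext k; exact arcMap_cotMap (mem_openCube.mp ht k)

lemma injOn_cotVec : Set.InjOn cotVec (openCube d) := fun s hs t ht h => by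
  rw [← arcVec_cotVec hs, ← arcVec_cotVec ht, h]

lemma image_cotVec : cotVec '' openCube d = Set.univ :=
  Set.eq_univ_of_forall fun x => ⟨arcVec x, arcVec_mem x, cotVec_arcVec x⟩

/-- The Jacobian determinant of the transform. -/
def cotJac (x : Fin d → ℝ) : ℝ := ∏ k, (π * (1 + x k ^ 2))

lemma cotJac_pos (x : Fin d → ℝ) : 0 < cotJac x :=
  Finset.prod_pos fun k _ => mul_pos Real.pi_pos (by positivity)

lemma continuous_cotJac : Continuous (cotJac (d := d)) := by
  unfold cotJac; fun_prop

lemma hasFDerivAt_cotVec {t : Fin d → ℝ} (ht : t ∈ openCube d) :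
    HasFDerivAt cotVec (ContinuousLinearMap.pi fun k =>
      (ContinuousLinearMap.toSpanSingleton ℝ (π * (1 + cotMap (t k) ^ 2))).comp
        (ContinuousLinearMap.proj (R := ℝ) (φ := fun _ : Fin d => ℝ) k)) t := by
  rw [hasFDerivAt_pi]
  intro k
  exact (hasDerivAt_cotMap (mem_openCube.mp ht k)).hasFDerivAt.comp t
    (ContinuousLinearMap.proj (R := ℝ) (φ := fun _ : Fin d => ℝ) k).hasFDerivAt

lemma det_cotVec (t : Fin d → ℝ) :
    |(ContinuousLinearMap.pi fun k =>
      (ContinuousLinearMap.toSpanSingleton ℝ (π * (1 + cotMap (t k) ^ 2))).comp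
        (ContinuousLinearMap.proj (R := ℝ) (φ := fun _ : Fin d => ℝ) k)).det| =
      cotJac (cotVec t) := by
  rw [ContinuousLinearMap.det_pi, abs_of_nonneg]
  · unfold cotJac cotVec
    refine Finset.prod_congr rfl fun k _ => ?_
    simp [ContinuousLinearMap.det]
  · refine Finset.prod_nonneg fun k _ => ?_
    have := Real.pi_pos
    simp [ContinuousLinearMap.det]
    positivity

lemma prod_deriv_cotMap {t : Fin d → ℝ} (ht : t ∈ openCube d) :
    ∏ k, deriv cotMap (t k) = cotJac (cotVec t) :=
  Finset.prod_congr rfl fun k _ => deriv_cotMap (mem_openCube.mp ht k)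

/-! ### Pulling functions back to the cube -/

variable {E : Type*} [NormedAddCommGroup E] [NormedSpace ℝ E]

open Classical in
/-- The transformed integrand of `H`, extended by zero to the complement of the open cube. -/
def cotPull (H : (Fin d → ℝ) → E) (t : Fin d → ℝ) : E :=
  if t ∈ openCube d then cotJac (cotVec t) • H (cotVec t) else 0

lemma cotPull_of_mem {H : (Fin d → ℝ) → E} {t : Fin d → ℝ} (ht : t ∈ openCube d) :
    cotPull H t = cotJac (cotVec t) • H (cotVec t) := if_pos ht

lemma cotPull_of_notMem {H : (Fin d → ℝ) → E} {t : Fin d → ℝ} (ht : t ∉ openCube d) :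
    cotPull H t = 0 := if_neg ht

lemma cotPull_eq_indicator (H : (Fin d → ℝ) → E) :
    cotPull H = (openCube d).indicator fun t => cotJac (cotVec t) • H (cotVec t) := by
  classical
  ext t
  by_cases ht : t ∈ openCube d
  · rw [cotPull_of_mem ht, Set.indicator_of_mem ht]
  · rw [cotPull_of_notMem ht, Set.indicator_of_notMem ht]

lemma cotIntegrand_eq_cotPull (f : (Fin d → ℝ) → ℝ) :
    cotIntegrand f = cotPull fun x => f x * gaussDensity x := by
  ext t
  unfold cotIntegrand
  by_cases ht : t ∈ openCube d
  · rw [if_pos (mem_openCube.mp ht), cotPull_of_mem ht, prod_deriv_cotMap ht, smul_eq_mul, mul_comm]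
    rfl
  · rw [if_neg (mt mem_openCube.mpr ht), cotPull_of_notMem ht]

/-- Change of variables on the open cube. No integrability is needed, as both sides are `0` when it
fails. -/
lemma setIntegral_cotPull (H : (Fin d → ℝ) → E) :
    ∫ t in Set.Icc 0 1, cotPull H t = ∫ x, H x := by
  have h := integral_image_eq_integral_abs_det_fderiv_smul volume
    (isOpen_openCube (d := d)).measurableSet
    (fun t ht => (hasFDerivAt_cotVec ht).hasFDerivWithinAt) injOn_cotVec H
  rw [image_cotVec, Measure.restrict_univ] at h
  rw [h, cotPull_eq_indicator, setIntegral_indicator isOpen_openCube.measurableSet,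
    Set.inter_eq_right.mpr openCube_subset]
  simp_rw [det_cotVec]

lemma integrableOn_cotPull {H : (Fin d → ℝ) → E} :
    IntegrableOn (cotPull H) (Set.Icc 0 1) ↔ Integrable H := by
  have h := integrableOn_image_iff_integrableOn_abs_det_fderiv_smul volume
    (isOpen_openCube (d := d)).measurableSet
    (fun t ht => (hasFDerivAt_cotVec ht).hasFDerivWithinAt) injOn_cotVec H
  rw [image_cotVec, integrableOn_univ] at h
  rw [h, cotPull_eq_indicator, IntegrableOn, integrable_indicator_iff isOpen_openCube.measurableSet,
    IntegrableOn, Measure.restrict_restrict isOpen_openCube.measurableSet,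
    Set.inter_eq_left.mpr openCube_subset]
  simp_rw [det_cotVec]
  rfl

/-- Null sets of the cube are mapped to null sets. -/
lemma ae_of_ae_cube {P : (Fin d → ℝ) → Prop}
    (h : ∀ᵐ t ∂(volume.restrict (Set.Icc (0 : Fin d → ℝ) 1)), t ∈ openCube d → P (cotVec t)) :
    ∀ᵐ x, P x := by
  have h' := ae_restrict_of_ae_restrict_of_subset (openCube_subset (d := d)) h
  rw [ae_restrict_iff' isOpen_openCube.measurableSet, ae_iff] at h'
  have h2 := addHaar_image_eq_zero_of_differentiableOn_of_addHaar_eq_zero volume (f := cotVec)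
    (s := {t | ¬(t ∈ openCube d → t ∈ openCube d → P (cotVec t))}) (fun t ht => by
      have : t ∈ openCube d := by by_contra hc; exact ht fun h => absurd h hc
      exact (hasFDerivAt_cotVec this).differentiableAt.differentiableWithinAt) h'
  rw [ae_iff]
  refine measure_mono_null (fun x hx => ?_) h2
  refine ⟨arcVec x, fun hc => hx ?_, cotVec_arcVec x⟩
  have := hc (arcVec_mem x) (arcVec_mem x)
  rwa [cotVec_arcVec] at this

end CotTransform

/-! ### Weak derivatives tested against tensor products -/

section Tensor

variable {d : ℕ}

/-- The tensor product of functions of one variable. -/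
def tensorFun (ψ : Fin d → ℝ → ℂ) (x : Fin d → ℝ) : ℂ := ∏ j, ψ j (x j)

lemma contDiff_tensorFun {ψ : Fin d → ℝ → ℂ} (hψ : ∀ j, ContDiff ℝ ∞ (ψ j)) :
    ContDiff ℝ ∞ (tensorFun ψ) := by
  unfold tensorFun
  exact contDiff_prod fun j _ => (hψ j).comp (contDiff_apply ℝ ℝ j)

lemma contDiff_iteratedDeriv {ψ : ℝ → ℂ} (hψ : ContDiff ℝ ∞ ψ) (n : ℕ) :
    ContDiff ℝ ∞ (iteratedDeriv n ψ) := by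
  induction n with
  | zero => simpa using hψ
  | succ n ih =>
    rw [iteratedDeriv_succ]
    exact (contDiff_infty_iff_deriv.mp ih).2

/-- Test functions for weak derivatives are real while the waves are complex, so `L` stands for the
real or the imaginary part. Along a coordinate line only one factor of the product varies. -/
lemma partialD_tensorFun (L : ℂ →L[ℝ] ℝ) {ψ : Fin d → ℝ → ℂ} (hψ : ∀ j, ContDiff ℝ ∞ (ψ j))
    (i : Fin d) :
    partialD i (fun x => L (tensorFun ψ x))
      = fun x => L (tensorFun (Function.update ψ i (deriv (ψ i))) x) := by
  ext x
  unfold partialD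
  have hF : DifferentiableAt ℝ (fun x => L (tensorFun ψ x)) x :=
    (L.contDiff.comp (contDiff_tensorFun hψ)).differentiable (by simp) x
  have h1 : HasDerivAt (fun s => L (tensorFun ψ (Function.update x i s)))
      (fderiv ℝ (fun x => L (tensorFun ψ x)) x (Pi.single i 1)) (x i) := by
    have h2 := hasDerivAt_update x i (x i)
    have h3 : HasFDerivAt (fun x => L (tensorFun ψ x)) (fderiv ℝ (fun x => L (tensorFun ψ x)) x)
      (Function.update x i (x i)) := by rw [Function.update_eq_self]; exact hF.hasFDerivAt
    exact h3.comp_hasDerivAt (x i) h2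
  have hsplit : ∀ (χ : ℝ → ℂ) (s : ℝ),
      tensorFun (Function.update ψ i χ) (Function.update x i s)
        = χ s * ∏ j ∈ Finset.univ.erase i, ψ j (x j) := by
    intro χ s
    unfold tensorFun
    rw [← Finset.mul_prod_erase _ _ (Finset.mem_univ i)]
    simp only [Function.update_self]
    congr 1
    refine Finset.prod_congr rfl fun j hj => ?_
    have hji := Finset.ne_of_mem_erase hj
    rw [Function.update_of_ne hji, Function.update_of_ne hji]
  have h4 : HasDerivAt (fun s => L (tensorFun ψ (Function.update x i s)))
      (L (deriv (ψ i) (x i) * ∏ j ∈ Finset.univ.erase i, ψ j (x j))) (x i) := by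
    have e : (fun s => L (tensorFun ψ (Function.update x i s)))
        = fun s => L (ψ i s * ∏ j ∈ Finset.univ.erase i, ψ j (x j)) := by
      ext s
      rw [← hsplit (ψ i) s, Function.update_eq_self]
    rw [e]
    have h5 : HasDerivAt (ψ i) (deriv (ψ i) (x i)) (x i) :=
      ((hψ i).differentiable (by simp) (x i)).hasDerivAt
    exact L.hasFDerivAt.comp_hasDerivAt (x i) (h5.mul_const _)
  rw [h1.unique h4, ← hsplit, Function.update_eq_self]

lemma partialD_iterate_tensorFun (L : ℂ →L[ℝ] ℝ) {ψ : Fin d → ℝ → ℂ}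
    (hψ : ∀ j, ContDiff ℝ ∞ (ψ j)) (i : Fin d) (n : ℕ) :
    (partialD i)^[n] (fun x => L (tensorFun ψ x))
      = fun x => L (tensorFun (Function.update ψ i (iteratedDeriv n (ψ i))) x) := by
  induction n with
  | zero => simp
  | succ n ih =>
    rw [Function.iterate_succ_apply', ih, partialD_tensorFun]
    · rw [Function.update_self, Function.update_idem, iteratedDeriv_succ]
    · intro j
      by_cases hj : j = i
      · subst hj; rw [Function.update_self]; exact contDiff_iteratedDeriv (hψ _) n
      · rw [Function.update_of_ne hj]; exact hψ j

/-- Induction along the list of coordinates; having no repetitions, it differentiates each factor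
exactly once, to order `r j`. -/
lemma mixedD_tensorFun (L : ℂ →L[ℝ] ℝ) {ψ : Fin d → ℝ → ℂ} (hψ : ∀ j, ContDiff ℝ ∞ (ψ j))
    (r : Fin d → ℕ) :
    mixedD r (fun x => L (tensorFun ψ x))
      = fun x => L (tensorFun (fun j => iteratedDeriv (r j) (ψ j)) x) := by
  have key : ∀ l : List (Fin d), l.Nodup →
      l.foldr (fun i χ => (partialD i)^[r i] χ) (fun x => L (tensorFun ψ x))
        = fun x => L (tensorFun (fun j => iteratedDeriv (if j ∈ l then r j else 0) (ψ j)) x) := by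
    intro l
    induction l with
    | nil => intro _; simp
    | cons i l ih =>
      intro hl
      obtain ⟨hil, hl'⟩ := List.nodup_cons.mp hl
      rw [List.foldr_cons, ih hl', partialD_iterate_tensorFun _
        (fun j => contDiff_iteratedDeriv (hψ j) _)]
      ext x
      congr 2
      ext j y
      by_cases hj : j = i
      · subst hj; simp [hil]
      · simp [hj]
  unfold mixedD
  rw [key _ (List.nodup_finRange d)]
  simp

lemma hasCompactSupport_tensorFun {ψ : Fin d → ℝ → ℂ} (hψ : ∀ j, HasCompactSupport (ψ j)) :
    HasCompactSupport (tensorFun ψ) := by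
  refine HasCompactSupport.intro (isCompact_univ_pi fun j => hψ j) fun x hx => ?_
  simp only [Set.mem_univ_pi, not_forall] at hx
  obtain ⟨j, hj⟩ := hx
  exact Finset.prod_eq_zero (Finset.mem_univ j) (image_eq_zero_of_notMem_tsupport hj)

lemma hasCompactSupport_iteratedDeriv {ψ : ℝ → ℂ} (hψ : HasCompactSupport ψ) (n : ℕ) :
    HasCompactSupport (iteratedDeriv n ψ) := by
  induction n with
  | zero => simpa using hψ
  | succ n ih => rw [iteratedDeriv_succ]; exact ih.deriv

lemma integrable_mul_tensorFun {f : (Fin d → ℝ) → ℝ} (hf : LocallyIntegrable f volume)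
    {ψ : Fin d → ℝ → ℂ} (hψ : ∀ j, Continuous (ψ j)) (hc : ∀ j, HasCompactSupport (ψ j)) :
    Integrable fun x => (f x : ℂ) * tensorFun ψ x := by
  have h1 : LocallyIntegrable (fun x => (f x : ℂ)) volume := by
    intro x
    obtain ⟨s, hs, hi⟩ := hf x
    exact ⟨s, hs, hi.ofReal⟩
  have hcont : Continuous (tensorFun ψ) := by
    unfold tensorFun
    exact continuous_finsetProd _ fun j _ => (hψ j).comp (continuous_apply j)
  have := h1.integrable_smul_left_of_hasCompactSupport hcont (hasCompactSupport_tensorFun hc)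
  refine this.congr (Filter.Eventually.of_forall fun x => ?_)
  simp only [smul_eq_mul]; ring

/-- A weak derivative tested against a tensor product of compactly supported functions. -/
lemma IsWeakDeriv.integral_tensorFun_of_hasCompactSupport {r : Fin d → ℕ}
    {f g : (Fin d → ℝ) → ℝ} (h : IsWeakDeriv r f g) {ψ : Fin d → ℝ → ℂ}
    (hψ : ∀ j, ContDiff ℝ ∞ (ψ j)) (hc : ∀ j, HasCompactSupport (ψ j)) :
    ∫ x, (f x : ℂ) * tensorFun (fun j => iteratedDeriv (r j) (ψ j)) x
      = (-1) ^ (∑ i, r i) * ∫ x, (g x : ℂ) * tensorFun ψ x := by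
  obtain ⟨hf, hg, hfg⟩ := h
  have hi1 := integrable_mul_tensorFun hf
    (fun j => (contDiff_iteratedDeriv (hψ j) (r j)).continuous)
    (fun j => hasCompactSupport_iteratedDeriv (hc j) (r j))
  have hi2 := integrable_mul_tensorFun hg (fun j => (hψ j).continuous) hc
  have key : ∀ L : ℂ →L[ℝ] ℝ, L (∫ x, (f x : ℂ) * tensorFun (fun j => iteratedDeriv (r j) (ψ j)) x)
      = (-1) ^ (∑ i, r i) * L (∫ x, (g x : ℂ) * tensorFun ψ x) := by
    intro L
    have hL : ∀ (a : ℝ) (z : ℂ), L (a * z) = a * L z := fun a z => by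
      rw [← smul_eq_mul (a : ℝ), ← L.map_smul]; simp
    rw [← L.integral_comp_comm hi1, ← L.integral_comp_comm hi2]
    simp_rw [hL]
    rw [← hfg (fun x => L (tensorFun ψ x)) (L.contDiff.comp (contDiff_tensorFun hψ))
      ((hasCompactSupport_tensorFun hc).comp_left (map_zero L)), mixedD_tensorFun L hψ]
  have hpow : ∀ z : ℂ, ((-1 : ℂ) ^ (∑ i, r i) * z) = (((-1) ^ (∑ i, r i) : ℝ) : ℂ) * z := by
    intro z; push_cast; rfl
  rw [hpow]
  refine Complex.ext ?_ ?_
  · rw [Complex.re_ofReal_mul]; exact key Complex.reCLM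
  · rw [Complex.im_ofReal_mul]; exact key Complex.imCLM

/-! ### Functions with Gaussian decay -/

/-- Smooth functions all of whose derivatives are `O(exp(-3x²/8))`. -/
def GaussDecay (ψ : ℝ → ℂ) : Prop :=
  ContDiff ℝ ∞ ψ ∧ ∀ n : ℕ, ∃ C, ∀ x, ‖iteratedDeriv n ψ x‖ ≤ C * Real.exp (-(3 / 8) * x ^ 2)

/-- A smooth cutoff function, equal to `1` on `[-1,1]`. -/
def unitCutoff (x : ℝ) : ℂ := ((⟨1, 2, one_pos, one_lt_two⟩ : ContDiffBump (0 : ℝ)) x : ℂ)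

lemma contDiff_unitCutoff : ContDiff ℝ ∞ unitCutoff :=
  Complex.ofRealCLM.contDiff.comp (ContDiffBump.contDiff _)

lemma hasCompactSupport_unitCutoff : HasCompactSupport unitCutoff :=
  (ContDiffBump.hasCompactSupport _).comp_left (g := Complex.ofReal) Complex.ofReal_zero

lemma unitCutoff_eq_one {x : ℝ} (hx : |x| ≤ 1) : unitCutoff x = 1 := by
  unfold unitCutoff
  rw [ContDiffBump.one_of_mem_closedBall]
  · simp
  · simpa using hx

lemma iteratedDeriv_comp_mul_left {ψ : ℝ → ℂ} (c : ℝ) (n : ℕ) :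
    iteratedDeriv n (fun x => ψ (c * x)) = fun x => (c : ℂ) ^ n * iteratedDeriv n ψ (c * x) := by
  induction n with
  | zero => simp
  | succ n ih =>
    rw [iteratedDeriv_succ, ih]
    ext x
    rw [deriv_const_mul_field, deriv_comp_mul_left, iteratedDeriv_succ, pow_succ]
    simp only [Complex.real_smul]
    ring

/-- The truncation of `ψ` to `[-2n-2, 2n+2]`. -/
def truncFun (ψ : ℝ → ℂ) (n : ℕ) (x : ℝ) : ℂ := unitCutoff ((n + 1 : ℝ)⁻¹ * x) * ψ x

lemma contDiff_truncFun {ψ : ℝ → ℂ} (hψ : ContDiff ℝ ∞ ψ) (n : ℕ) :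
    ContDiff ℝ ∞ (truncFun ψ n) :=
  (contDiff_unitCutoff.comp (contDiff_const.mul contDiff_id)).mul hψ

lemma hasCompactSupport_truncFun (ψ : ℝ → ℂ) (n : ℕ) : HasCompactSupport (truncFun ψ n) := by
  have h : HasCompactSupport fun x : ℝ => unitCutoff ((n + 1 : ℝ)⁻¹ * x) :=
    hasCompactSupport_unitCutoff.comp_homeomorph
      (Homeomorph.mulLeft₀ ((n + 1 : ℝ)⁻¹) (by positivity))
  exact h.mul_right

/-- Near a given point the cutoff is eventually identically `1`, so the sequence is eventually
constant. -/
lemma tendsto_iteratedDeriv_truncFun (ψ : ℝ → ℂ) (r : ℕ) (x : ℝ) :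
    Filter.Tendsto (fun n => iteratedDeriv r (truncFun ψ n) x) Filter.atTop
      (nhds (iteratedDeriv r ψ x)) := by
  refine tendsto_const_nhds.congr' ?_
  obtain ⟨m, hm⟩ := exists_nat_gt |x|
  filter_upwards [Filter.eventually_ge_atTop m] with n hn
  refine (Filter.EventuallyEq.iteratedDeriv_eq r ?_).symm
  have hmn : (m : ℝ) ≤ n := by exact_mod_cast hn
  have h1 : ∀ᶠ y : ℝ in nhds x, |y| < (n : ℝ) + 1 :=
    (continuous_abs.tendsto x).eventually_lt_const (by linarith)
  filter_upwards [h1] with y hy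
  unfold truncFun
  rw [unitCutoff_eq_one, one_mul]
  have hn0 : (0 : ℝ) < n + 1 := by positivity
  rw [abs_mul, abs_of_pos (inv_pos.mpr hn0), inv_mul_le_iff₀ hn0]
  linarith

/-- By Leibniz: each derivative of the dilated cutoff brings a factor `(n+1)⁻¹ ≤ 1`, so the bound is
uniform in `n`. -/
lemma exists_bound_iteratedDeriv_truncFun {ψ : ℝ → ℂ} (hψ : GaussDecay ψ) (r : ℕ) :
    ∃ C, 0 ≤ C ∧ ∀ n x, ‖iteratedDeriv r (truncFun ψ n) x‖ ≤ C * Real.exp (-(3 / 8) * x ^ 2) := by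
  have hb : ∀ i : ℕ, ∃ C, ∀ x, ‖iteratedDeriv i unitCutoff x‖ ≤ C := fun i =>
    (hasCompactSupport_iteratedDeriv hasCompactSupport_unitCutoff i).exists_bound_of_continuous
      (contDiff_iteratedDeriv contDiff_unitCutoff i).continuous
  choose A hA using hb
  choose B hB using hψ.2
  have hA0 : ∀ i, 0 ≤ A i := fun i => (norm_nonneg _).trans (hA i 0)
  have hB0 : ∀ i, 0 ≤ B i := fun i => by
    have := (norm_nonneg _).trans (hB i 0)
    simpa using this
  refine ⟨∑ i ∈ Finset.range (r + 1), (r.choose i) * A i * B (r - i),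
    Finset.sum_nonneg fun i _ => mul_nonneg (mul_nonneg (by positivity) (hA0 i)) (hB0 _),
    fun n x => ?_⟩
  have hs : ContDiff ℝ ∞ fun x : ℝ => unitCutoff ((n + 1 : ℝ)⁻¹ * x) :=
    contDiff_unitCutoff.comp (contDiff_const.mul contDiff_id)
  unfold truncFun
  rw [iteratedDeriv_fun_mul ((hs.of_le (by exact_mod_cast le_top)).contDiffAt)
    ((hψ.1.of_le (by exact_mod_cast le_top)).contDiffAt), Finset.sum_mul]
  refine (norm_sum_le _ _).trans (Finset.sum_le_sum fun i _ => ?_)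
  rw [norm_mul, norm_mul, iteratedDeriv_comp_mul_left, norm_mul, norm_pow, Complex.norm_real,
    Complex.norm_natCast]
  have h1 : ‖((n + 1 : ℝ)⁻¹)‖ ^ i ≤ 1 := by
    refine pow_le_one₀ (norm_nonneg _) ?_
    rw [Real.norm_of_nonneg (by positivity)]
    exact inv_le_one_of_one_le₀ (by have : (0 : ℝ) ≤ n := by positivity
                                    linarith)
  calc _ ≤ (r.choose i : ℝ) * (1 * A i) * (B (r - i) * Real.exp (-(3 / 8) * x ^ 2)) := by
        gcongr
        · exact mul_nonneg (by positivity) (mul_nonneg zero_le_one (hA0 i))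
        · exact hA i _
        · exact hB _ _
    _ = _ := by ring

lemma GaussDecay.exists_bound {ψ : ℝ → ℂ} (hψ : GaussDecay ψ) (r : ℕ) :
    ∃ C, 0 ≤ C ∧ ∀ x, ‖iteratedDeriv r ψ x‖ ≤ C * Real.exp (-(3 / 8) * x ^ 2) := by
  obtain ⟨C, hC⟩ := hψ.2 r
  refine ⟨C, ?_, hC⟩
  have := (norm_nonneg _).trans (hC 0)
  simpa using this

lemma gaussDensity_eq_prod (x : Fin d → ℝ) :
    gaussDensity x = ∏ j, (Real.exp (-(x j ^ 2) / 2) / √(2 * π)) := by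
  unfold gaussDensity
  rw [Finset.prod_div_distrib, ← Real.exp_sum, Finset.prod_const, Finset.card_univ,
    Fintype.card_fin]
  congr 1
  · congr 1
    rw [← Finset.sum_div, Finset.sum_neg_distrib]
  · rw [Real.sqrt_eq_rpow, ← Real.rpow_natCast, ← Real.rpow_mul (by positivity)]
    congr 1; ring

/-- With `3/8 = 1/4 + 1/8`, the integrand is at most `f² exp(-|x|²/2) + exp(-|x|²/4)`. The rate
`3/8` exceeds `1/4`, so that functions in `L²_ρ` pair with it, and is below `1/2`, so that a
Gaussian times a polynomial decays at least this fast. -/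
lemma integrable_abs_mul_exp {f : (Fin d → ℝ) → ℝ} (hf : AEStronglyMeasurable f volume)
    (hi : Integrable fun x => f x ^ 2 * gaussDensity x) :
    Integrable fun x => |f x| * ∏ j, Real.exp (-(3 / 8) * x j ^ 2) := by
  have hi2 : Integrable fun x : Fin d → ℝ => ∏ j, Real.exp (-(1 / 4) * x j ^ 2) :=
    Integrable.fintype_prod fun _ => integrable_exp_neg_mul_sq (by norm_num)
  have hi1 : Integrable fun x : Fin d → ℝ => f x ^ 2 * ∏ j, Real.exp (-(1 / 2) * x j ^ 2) := by
    refine (hi.mul_const ((√(2 * π)) ^ d)).congr (Filter.Eventually.of_forall fun x => ?_)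
    simp only [gaussDensity_eq_prod, Finset.prod_div_distrib, Finset.prod_const, Finset.card_univ,
      Fintype.card_fin]
    have : (√(2 * π)) ^ d ≠ 0 := pow_ne_zero _ (by positivity)
    rw [mul_assoc, div_mul_cancel₀ _ this]
    congr 1
    refine Finset.prod_congr rfl fun j _ => ?_
    congr 1; ring
  refine (hi1.add hi2).mono' ?_ (Filter.Eventually.of_forall fun x => ?_)
  · refine AEStronglyMeasurable.mul (by simpa using hf.norm) ?_
    exact Continuous.aestronglyMeasurable (by fun_prop)
  · rw [Real.norm_of_nonneg (by positivity), Pi.add_apply]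
    set a := ∏ j, Real.exp (-(1 / 4) * x j ^ 2) with ha
    set b := ∏ j, Real.exp (-(1 / 8) * x j ^ 2) with hb
    have e1 : ∏ j, Real.exp (-(3 / 8) * x j ^ 2) = a * b := by
      rw [ha, hb, ← Finset.prod_mul_distrib]
      refine Finset.prod_congr rfl fun j _ => ?_
      rw [← Real.exp_add]; congr 1; ring
    have e2 : ∏ j, Real.exp (-(1 / 2) * x j ^ 2) = a * a := by
      rw [ha, ← Finset.prod_mul_distrib]
      refine Finset.prod_congr rfl fun j _ => ?_
      rw [← Real.exp_add]; congr 1; ring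
    have e3 : a = b * b := by
      rw [ha, hb, ← Finset.prod_mul_distrib]
      refine Finset.prod_congr rfl fun j _ => ?_
      rw [← Real.exp_add]; congr 1; ring
    have hb0 : 0 ≤ b := by positivity
    have h1 : (|f x| * a) ^ 2 = f x ^ 2 * (a * a) := by rw [mul_pow, sq_abs]; ring
    rw [e1, e2, ← h1, e3, ← e3]
    nlinarith [sq_nonneg (|f x| * a - b), sq_nonneg b, sq_nonneg (|f x| * a)]

lemma integrable_mul_tensorFun_of_bound {f : (Fin d → ℝ) → ℝ} (hf : AEStronglyMeasurable f volume)
    (hi : Integrable fun x => f x ^ 2 * gaussDensity x) {ψ : Fin d → ℝ → ℂ}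
    (hψ : ∀ j, GaussDecay (ψ j)) (r : Fin d → ℕ) :
    Integrable fun x => (f x : ℂ) * tensorFun (fun j => iteratedDeriv (r j) (ψ j)) x := by
  choose C hC0 hC using fun j => (hψ j).exists_bound (r j)
  refine ((integrable_abs_mul_exp hf hi).mul_const (∏ j, C j)).mono' ?_
    (Filter.Eventually.of_forall fun x => ?_)
  · refine AEStronglyMeasurable.mul (Complex.continuous_ofReal.comp_aestronglyMeasurable hf) ?_
    unfold tensorFun
    exact (continuous_finsetProd _ fun j _ => (contDiff_iteratedDeriv (hψ j).1 _).continuous.comp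
      (continuous_apply j)).aestronglyMeasurable
  · rw [norm_mul, Complex.norm_real, Real.norm_eq_abs, mul_assoc, ← Finset.prod_mul_distrib]
    unfold tensorFun
    rw [norm_prod]
    gcongr with j
    rw [mul_comm]; exact hC j _

/-- A weak derivative tested against a tensor product of functions with Gaussian decay. -/
lemma IsWeakDeriv.integral_tensorFun {r : Fin d → ℕ} {f g : (Fin d → ℝ) → ℝ}
    (h : IsWeakDeriv r f g) (hf : Integrable fun x => f x ^ 2 * gaussDensity x)
    (hg : Integrable fun x => g x ^ 2 * gaussDensity x) {ψ : Fin d → ℝ → ℂ}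
    (hψ : ∀ j, GaussDecay (ψ j)) :
    ∫ x, (f x : ℂ) * tensorFun (fun j => iteratedDeriv (r j) (ψ j)) x
      = (-1) ^ (∑ i, r i) * ∫ x, (g x : ℂ) * tensorFun ψ x := by
  -- Dominated convergence as the truncation is removed; it serves for `f` with orders `r` and for
  -- `g` with order `0`.
  have hlim : ∀ (F : (Fin d → ℝ) → ℝ), LocallyIntegrable F volume →
      (Integrable fun x => F x ^ 2 * gaussDensity x) → ∀ s : Fin d → ℕ,
      Filter.Tendsto (fun n : ℕ => ∫ x, (F x : ℂ) *
          tensorFun (fun j => iteratedDeriv (s j) (truncFun (ψ j) n)) x) Filter.atTop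
        (nhds (∫ x, (F x : ℂ) * tensorFun (fun j => iteratedDeriv (s j) (ψ j)) x)) := by
    intro F hF hFi s
    choose C hC0 hC using fun j => exists_bound_iteratedDeriv_truncFun (hψ j) (s j)
    refine tendsto_integral_of_dominated_convergence
      (fun x => (|F x| * ∏ j, Real.exp (-(3 / 8) * x j ^ 2)) * ∏ j, C j) (fun n => ?_)
      ((integrable_abs_mul_exp hF.aestronglyMeasurable hFi).mul_const _) (fun n => ?_) ?_
    · exact (integrable_mul_tensorFun hF (fun j =>
        (contDiff_iteratedDeriv (contDiff_truncFun (hψ j).1 n) (s j)).continuous) fun j =>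
        hasCompactSupport_iteratedDeriv (hasCompactSupport_truncFun _ n) _).aestronglyMeasurable
    · refine Filter.Eventually.of_forall fun x => ?_
      rw [norm_mul, Complex.norm_real, Real.norm_eq_abs, mul_assoc, ← Finset.prod_mul_distrib]
      unfold tensorFun
      rw [norm_prod]
      gcongr with j
      rw [mul_comm]; exact hC j n _
    · refine Filter.Eventually.of_forall fun x => ?_
      refine Filter.Tendsto.const_mul _ ?_
      unfold tensorFun
      exact tendsto_finsetProd _ fun j _ => tendsto_iteratedDeriv_truncFun _ _ _
  have h1 := hlim f h.1 hf r
  have h2 := (hlim g h.2.1 hg 0).const_mul ((-1 : ℂ) ^ (∑ i, r i))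
  simp only [Pi.zero_apply, iteratedDeriv_zero] at h2
  refine tendsto_nhds_unique h1 (h2.congr fun n => ?_)
  exact (h.integral_tensorFun_of_hasCompactSupport (fun j => contDiff_truncFun (hψ j).1 n)
    fun j => hasCompactSupport_truncFun _ n).symm

end Tensor

/-! ### Gaussian wave functions -/

section Waves

open Polynomial

/-- The one-dimensional Gaussian density. -/
def gauss1 (x : ℝ) : ℝ := Real.exp (-(x ^ 2) / 2) / √(2 * π)

lemma gauss1_pos (x : ℝ) : 0 < gauss1 x := by unfold gauss1; positivity

/-- The character `exp(-2πi k t)` in the variable `x = φ(t)`. -/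
def waveFun (k : ℤ) (x : ℝ) : ℂ := Complex.exp (-(2 * π * Complex.I * (k * arcMap x)))

lemma norm_waveFun (k : ℤ) (x : ℝ) : ‖waveFun k x‖ = 1 := by
  unfold waveFun
  rw [show -(2 * π * Complex.I * (k * arcMap x)) = ((-(2 * π * (k * arcMap x)) : ℝ) : ℂ) * Complex.I
    by push_cast; ring]
  exact Complex.norm_exp_ofReal_mul_I _

/-- `(1 + x²)⁻¹`. -/
def cauchyInv (x : ℝ) : ℂ := (1 + (x : ℂ) ^ 2)⁻¹

lemma one_add_sq_ne_zero (x : ℝ) : (1 + (x : ℂ) ^ 2) ≠ 0 := by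
  have : (1 + x ^ 2 : ℝ) ≠ 0 := by positivity
  exact_mod_cast this

lemma norm_cauchyInv_le (x : ℝ) : ‖cauchyInv x‖ ≤ 1 := by
  unfold cauchyInv
  rw [show (1 + (x : ℂ) ^ 2)⁻¹ = (((1 + x ^ 2)⁻¹ : ℝ) : ℂ) by push_cast; rfl, Complex.norm_real,
    Real.norm_of_nonneg (by positivity)]
  exact inv_le_one_of_one_le₀ (by nlinarith [sq_nonneg x])

/-- The product of the Gaussian density, a polynomial, a power of `(1 + x²)⁻¹` and a wave. -/
def gaussRat (P : ℂ[X]) (j : ℕ) (k : ℤ) (x : ℝ) : ℂ :=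
  gauss1 x * (P.eval (x : ℂ) * cauchyInv x ^ j) * waveFun k x

/-- The product of the Gaussian density, a polynomial and a wave. -/
def gaussPoly (P : ℂ[X]) (k : ℤ) (x : ℝ) : ℂ := gauss1 x * P.eval (x : ℂ) * waveFun k x

lemma gaussPoly_eq_gaussRat (P : ℂ[X]) (k : ℤ) : gaussPoly P k = gaussRat P 0 k := by
  ext x; simp [gaussPoly, gaussRat]

lemma hasDerivAt_gauss1 (x : ℝ) : HasDerivAt gauss1 (-x * gauss1 x) x := by
  unfold gauss1
  have h : HasDerivAt (fun x : ℝ => -(x ^ 2) / 2) (-x) x := by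
    refine (((hasDerivAt_pow 2 x).fun_neg).div_const 2).congr_deriv ?_
    push_cast; ring
  refine (h.exp.div_const _).congr_deriv ?_
  ring

/-- The derivative of `arcMap` is `1/(π(1+x²))`, which cancels the `π` in the exponent. -/
lemma hasDerivAt_waveFun (k : ℤ) (x : ℝ) :
    HasDerivAt (waveFun k) (-(2 * Complex.I * k * cauchyInv x) * waveFun k x) x := by
  have h1 : HasDerivAt arcMap ((1 + x ^ 2)⁻¹ / π) x := by
    unfold arcMap
    refine (((Real.hasDerivAt_arctan x).div_const π).const_add (1 / 2)).congr_deriv ?_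
    rw [one_div]
  have h2 := ((((h1.ofReal_comp).const_mul (k : ℂ)).const_mul (2 * π * Complex.I)).fun_neg).cexp
  refine h2.congr_deriv ?_
  unfold waveFun cauchyInv
  have hpi : (π : ℂ) ≠ 0 := by exact_mod_cast Real.pi_ne_zero
  have := one_add_sq_ne_zero x
  push_cast
  field_simp

lemma hasDerivAt_cauchyInv_pow (j : ℕ) (x : ℝ) :
    HasDerivAt (fun x => cauchyInv x ^ j) (-(2 * (j : ℂ) * (x : ℂ)) * cauchyInv x ^ (j + 1)) x := by
  have h1 : HasDerivAt (fun x : ℝ => 1 + (x : ℂ) ^ 2) ((2 : ℂ) * (x : ℂ)) x := by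
    refine (((hasDerivAt_id x).ofReal_comp.fun_pow 2).const_add 1).congr_deriv ?_
    simp
  have h2 : HasDerivAt cauchyInv (-((2 : ℂ) * (x : ℂ)) * cauchyInv x ^ 2) x := by
    refine (h1.inv (one_add_sq_ne_zero x)).congr_deriv ?_
    unfold cauchyInv
    rw [inv_pow, div_eq_mul_inv]
  refine (h2.fun_pow j).congr_deriv ?_
  cases j with
  | zero => simp
  | succ n => simp only [Nat.add_sub_cancel]; push_cast; ring

/-- The class is closed under differentiation, each derivative costing one more power of `(1+x²)⁻¹`;
smoothness and Gaussian decay of all derivatives follow. -/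
lemma hasDerivAt_gaussRat (P : ℂ[X]) (j : ℕ) (k : ℤ) (x : ℝ) :
    HasDerivAt (gaussRat P j k) (gaussRat ((derivative P - X * P) * (1 + X ^ 2)
      - C (2 * (j : ℂ)) * X * P - C (2 * Complex.I * k) * P) (j + 1) k x) x := by
  have hP : HasDerivAt (fun x : ℝ => P.eval (x : ℂ)) ((derivative P).eval (x : ℂ)) x :=
    (P.hasDerivAt (x : ℂ)).comp_ofReal
  have h := (((hasDerivAt_gauss1 x).ofReal_comp).mul (hP.mul (hasDerivAt_cauchyInv_pow j x))).mul
    (hasDerivAt_waveFun k x)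
  refine h.congr_deriv ?_
  have hw : cauchyInv x ^ j = (1 + (x : ℂ) ^ 2) * cauchyInv x ^ (j + 1) := by
    have : cauchyInv x * (1 + (x : ℂ) ^ 2) = 1 := inv_mul_cancel₀ (one_add_sq_ne_zero x)
    rw [pow_succ]
    linear_combination (-cauchyInv x ^ j) * this
  simp only [gaussRat, Pi.mul_apply, eval_sub, eval_mul, eval_X, eval_add, eval_one, eval_pow, eval_C]
  push_cast
  linear_combination (((derivative P).eval (x : ℂ) - x * P.eval (x : ℂ)) * gauss1 x
    * waveFun k x) * hw

lemma deriv_gaussRat (P : ℂ[X]) (j : ℕ) (k : ℤ) :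
    ∃ Q : ℂ[X], deriv (gaussRat P j k) = gaussRat Q (j + 1) k :=
  ⟨_, funext fun x => (hasDerivAt_gaussRat P j k x).deriv⟩

lemma iteratedDeriv_gaussRat (n : ℕ) : ∀ (P : ℂ[X]) (j : ℕ) (k : ℤ),
    ∃ Q : ℂ[X], iteratedDeriv n (gaussRat P j k) = gaussRat Q (j + n) k := by
  induction n with
  | zero => intro P j k; exact ⟨P, by simp⟩
  | succ n ih =>
    intro P j k
    obtain ⟨Q, hQ⟩ := deriv_gaussRat P j k
    obtain ⟨R, hR⟩ := ih Q (j + 1) k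
    exact ⟨R, by rw [iteratedDeriv_succ', hQ, hR]; congr 1; ring⟩

lemma contDiff_gaussRat (P : ℂ[X]) (j : ℕ) (k : ℤ) : ContDiff ℝ ∞ (gaussRat P j k) := by
  refine contDiff_of_differentiable_iteratedDeriv fun m _ => ?_
  obtain ⟨Q, hQ⟩ := iteratedDeriv_gaussRat m P j k
  rw [hQ]
  exact fun x => (hasDerivAt_gaussRat Q _ k x).differentiableAt

lemma exists_norm_eval_le (P : ℂ[X]) :
    ∃ A, 0 ≤ A ∧ ∀ x : ℝ, ‖P.eval (x : ℂ)‖ ≤ A * Real.exp (1 / 8 * x ^ 2) := by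
  induction P using Polynomial.induction_on' with
  | add P Q hP hQ =>
    obtain ⟨A, hA0, hA⟩ := hP
    obtain ⟨B, hB0, hB⟩ := hQ
    refine ⟨A + B, add_nonneg hA0 hB0, fun x => ?_⟩
    rw [eval_add, add_mul]
    exact (norm_add_le _ _).trans (add_le_add (hA x) (hB x))
  | monomial n a =>
    refine ⟨‖a‖ * (n.factorial * Real.exp 2), by positivity, fun x => ?_⟩
    rw [eval_monomial, norm_mul, norm_pow, Complex.norm_real, Real.norm_eq_abs, mul_assoc]
    gcongr
    have h1 := Real.pow_div_factorial_le_exp |x| (abs_nonneg x) n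
    rw [div_le_iff₀ (by positivity)] at h1
    refine h1.trans ?_
    rw [mul_comm, mul_assoc, ← Real.exp_add]
    gcongr
    nlinarith [sq_nonneg (|x| - 4), sq_abs x]

lemma gauss1_le (x : ℝ) : gauss1 x ≤ Real.exp (-(1 / 2) * x ^ 2) := by
  unfold gauss1
  rw [show -(x ^ 2) / 2 = -(1 / 2) * x ^ 2 by ring]
  refine div_le_self (Real.exp_nonneg _) ?_
  rw [Real.one_le_sqrt]
  nlinarith [Real.pi_gt_three]

lemma gaussDecay_gaussRat (P : ℂ[X]) (j : ℕ) (k : ℤ) : GaussDecay (gaussRat P j k) := by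
  refine ⟨contDiff_gaussRat P j k, fun n => ?_⟩
  obtain ⟨Q, hQ⟩ := iteratedDeriv_gaussRat n P j k
  obtain ⟨A, hA0, hA⟩ := exists_norm_eval_le Q
  refine ⟨A, fun x => ?_⟩
  rw [hQ]
  unfold gaussRat
  rw [norm_mul, norm_waveFun, mul_one, norm_mul, norm_mul, norm_pow, Complex.norm_real,
    Real.norm_of_nonneg (gauss1_pos x).le]
  calc _ ≤ Real.exp (-(1 / 2) * x ^ 2) * ((A * Real.exp (1 / 8 * x ^ 2)) * 1) := by
        gcongr
        · exact gauss1_le x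
        · exact hA x
        · exact pow_le_one₀ (norm_nonneg _) (norm_cauchyInv_le x)
    _ = A * (Real.exp (-(1 / 2) * x ^ 2) * Real.exp (1 / 8 * x ^ 2)) := by ring
    _ = _ := by rw [← Real.exp_add]; congr 2; ring

lemma gaussDecay_gaussPoly (P : ℂ[X]) (k : ℤ) : GaussDecay (gaussPoly P k) := by
  rw [gaussPoly_eq_gaussRat]; exact gaussDecay_gaussRat P 0 k

lemma gaussPoly_linear (c e : ℂ) (P Q : ℂ[X]) (k : ℤ) :
    gaussPoly (C c * P + C e * Q) k = fun x => c * gaussPoly P k x + e * gaussPoly Q k x := by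
  ext x
  simp only [gaussPoly, eval_add, eval_mul, eval_C]
  ring

lemma iteratedDeriv_gaussPoly_linear (n : ℕ) (c e : ℂ) (P Q : ℂ[X]) (k : ℤ) (x : ℝ) :
    iteratedDeriv n (gaussPoly (C c * P + C e * Q) k) x
      = c * iteratedDeriv n (gaussPoly P k) x + e * iteratedDeriv n (gaussPoly Q k) x := by
  have hs : ∀ R : ℂ[X], ContDiffAt ℝ n (gaussPoly R k) x := fun R =>
    ((gaussDecay_gaussPoly R k).1.of_le (by exact_mod_cast le_top)).contDiffAt
  rw [gaussPoly_linear, iteratedDeriv_fun_add (contDiffAt_const.mul (hs P))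
    (contDiffAt_const.mul (hs Q)), iteratedDeriv_const_mul_field, iteratedDeriv_const_mul_field]

/-- Differentiating `(1+x²) P γ w`, with `γ` the Gaussian and `w` the wave, the term from `w` is
`-2ik P γ w`: the added factor `1+x²` cancels the denominator, so only polynomials remain. Solve for
`k P γ w`. -/
lemma mul_gaussPoly (P : ℂ[X]) (k : ℤ) :
    ∀ x, (k : ℂ) * gaussPoly P k x = Complex.I / 2 * (deriv (gaussPoly ((1 + X ^ 2) * P) k) x
      - gaussPoly (derivative ((1 + X ^ 2) * P) - X * ((1 + X ^ 2) * P)) k x) := by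
  intro x
  have h := (hasDerivAt_gaussRat ((1 + X ^ 2) * P) 0 k x).deriv
  rw [gaussPoly_eq_gaussRat ((1 + X ^ 2) * P), h]
  have hw : cauchyInv x * (1 + (x : ℂ) ^ 2) = 1 := inv_mul_cancel₀ (one_add_sq_ne_zero x)
  simp only [gaussRat, gaussPoly, eval_sub, eval_mul, eval_X, eval_add, eval_one, eval_pow, eval_C,
    zero_add, pow_one, Nat.cast_zero, mul_zero, zero_mul, sub_zero]
  generalize eval (x : ℂ) (derivative ((1 + X ^ 2) * P)) = D
  have e : (D - x * ((1 + (x : ℂ) ^ 2) * eval (x : ℂ) P)) * (1 + (x : ℂ) ^ 2)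
      - 2 * Complex.I * k * ((1 + (x : ℂ) ^ 2) * eval (x : ℂ) P)
      = (1 + (x : ℂ) ^ 2) * (D - x * ((1 + (x : ℂ) ^ 2) * eval (x : ℂ) P)
        - 2 * Complex.I * k * eval (x : ℂ) P) := by ring
  have e2 : ∀ Y : ℂ, (1 + (x : ℂ) ^ 2) * Y * cauchyInv x = Y := fun Y => by
    rw [mul_right_comm, mul_comm (1 + (x : ℂ) ^ 2), hw, one_mul]
  rw [e, e2]
  linear_combination (gauss1 x * eval (x : ℂ) P * waveFun k x * k : ℂ) * Complex.I_sq

/-- Powers of the frequency become derivatives. -/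
lemma exists_pow_mul_gaussPoly (α : ℕ) : ∀ P : ℂ[X], ∃ A : ℕ → ℂ[X], ∀ (k : ℤ) (x : ℝ),
    (k : ℂ) ^ α * gaussPoly P k x
      = ∑ r ∈ Finset.range (α + 1), iteratedDeriv r (gaussPoly (A r) k) x := by
  induction α with
  | zero => intro P; exact ⟨fun _ => P, fun k x => by simp⟩
  | succ α ih =>
    intro P
    obtain ⟨A, hA⟩ := ih ((1 + X ^ 2) * P)
    obtain ⟨B, hB⟩ := ih (derivative ((1 + X ^ 2) * P) - X * ((1 + X ^ 2) * P))
    -- The derivative in `mul_gaussPoly` raises the orders of the `A` terms by one, while the `B`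
    -- terms keep theirs; zero polynomials fill the missing orders `0` and `α + 1`.
    refine ⟨fun r => C (Complex.I / 2) * (if r = 0 then 0 else A (r - 1))
      + C (-(Complex.I / 2)) * (if r = α + 1 then 0 else B r), fun k x => ?_⟩
    have hz : ∀ n, iteratedDeriv n (gaussPoly 0 k) x = 0 := fun n => by
      have : gaussPoly 0 k = fun _ => 0 := by ext y; simp [gaussPoly]
      rw [this]; simp
    simp_rw [iteratedDeriv_gaussPoly_linear]
    rw [Finset.sum_add_distrib, ← Finset.mul_sum, ← Finset.mul_sum, Finset.sum_range_succ']
    rw [Finset.sum_range_succ (fun r => iteratedDeriv r (gaussPoly (if r = α + 1 then 0 else B r) k) x)]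
    simp only [if_true, hz, add_zero, Nat.add_sub_cancel, Nat.succ_ne_zero, if_false]
    have e1 : ∑ r ∈ Finset.range (α + 1),
        iteratedDeriv r (gaussPoly (if r = α + 1 then 0 else B r) k) x
        = ∑ r ∈ Finset.range (α + 1), iteratedDeriv r (gaussPoly (B r) k) x :=
      Finset.sum_congr rfl fun r hr => by
        rw [if_neg (by have := Finset.mem_range.mp hr; omega)]
    rw [e1, ← hB]
    have e2 : (k : ℂ) ^ α * deriv (gaussPoly ((1 + X ^ 2) * P) k) x
        = ∑ r ∈ Finset.range (α + 1), iteratedDeriv (r + 1) (gaussPoly (A r) k) x := by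
      have hfun : (fun x => (k : ℂ) ^ α * gaussPoly ((1 + X ^ 2) * P) k x)
          = fun x => ∑ r ∈ Finset.range (α + 1), iteratedDeriv r (gaussPoly (A r) k) x := by
        ext y; exact hA k y
      have hd := congrArg (fun F => deriv F x) hfun
      simp only [deriv_const_mul_field] at hd
      rw [hd, deriv_fun_sum]
      · simp_rw [iteratedDeriv_succ]
      · intro r _
        exact (contDiff_iteratedDeriv (gaussDecay_gaussPoly (A r) k).1 r).differentiable
          (by simp) x
    rw [← e2, pow_succ, mul_assoc, mul_gaussPoly]
    ring

end Waves

/-! ### The Korobov norm of the transformed integrand -/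

section KorobovEstimate

open Polynomial

variable {d : ℕ}

lemma IsWeakDeriv.ae_eq {r : Fin d → ℕ} {f g g' : (Fin d → ℝ) → ℝ} (h : IsWeakDeriv r f g)
    (h' : IsWeakDeriv r f g') : g =ᵐ[volume] g' := by
  refine ae_eq_of_integral_contDiff_smul_eq h.2.1 h'.2.1 fun φ hφ hc => ?_
  have h1 := h.2.2 φ hφ hc
  rw [h'.2.2 φ hφ hc] at h1
  have h2 := mul_left_cancel₀ (pow_ne_zero _ (by norm_num)) h1
  simp only [smul_eq_mul, mul_comm (φ _)]
  exact h2.symm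

lemma MemSobolev.isWeakDeriv {α : ℕ} {f : (Fin d → ℝ) → ℝ} (hf : MemSobolev α f)
    {r : Fin d → ℕ} (hr : r ∈ multiIndices α d) : IsWeakDeriv r f (weakDeriv r f) := by
  have h : ∃ g, IsWeakDeriv r f g := ⟨_, (hf r hr).choose_spec.1⟩
  unfold weakDeriv
  rw [dif_pos h]
  exact h.choose_spec

lemma MemSobolev.integrable_weakDeriv {α : ℕ} {f : (Fin d → ℝ) → ℝ} (hf : MemSobolev α f)
    {r : Fin d → ℕ} (hr : r ∈ multiIndices α d) :
    Integrable fun x => weakDeriv r f x ^ 2 * gaussDensity x := by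
  obtain ⟨g, hg, hgi⟩ := hf r hr
  refine hgi.congr ?_
  filter_upwards [hg.ae_eq (hf.isWeakDeriv hr)] with x hx
  rw [hx]

lemma zero_mem_multiIndices (α : ℕ) : (0 : Fin d → ℕ) ∈ multiIndices α d := by
  simp [multiIndices]

lemma MemSobolev.locallyIntegrable {α : ℕ} {f : (Fin d → ℝ) → ℝ} (hf : MemSobolev α f) :
    LocallyIntegrable f volume := (hf.isWeakDeriv (zero_mem_multiIndices α)).1

/-- Membership only provides some weak derivative of order zero in `L²_ρ`; by uniqueness it agrees
with `f` almost everywhere. -/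
lemma MemSobolev.integrable_sq {α : ℕ} {f : (Fin d → ℝ) → ℝ} (hf : MemSobolev α f) :
    Integrable fun x => f x ^ 2 * gaussDensity x := by
  have h0 := zero_mem_multiIndices (d := d) α
  have hself : IsWeakDeriv 0 f f := by
    refine ⟨hf.locallyIntegrable, hf.locallyIntegrable, fun φ _ _ => ?_⟩
    have : mixedD 0 φ = φ := by
      unfold mixedD
      induction List.finRange d with
      | nil => rfl
      | cons i l ih => rw [List.foldr_cons, ih]; rfl
    simp [this]
  refine (hf.integrable_weakDeriv h0).congr ?_
  filter_upwards [hself.ae_eq (hf.isWeakDeriv h0)] with x hx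
  rw [hx]

lemma gaussDensity_eq_prod_gauss1 (x : Fin d → ℝ) : gaussDensity x = ∏ j, gauss1 (x j) :=
  gaussDensity_eq_prod x

lemma gaussDensity_pos (x : Fin d → ℝ) : 0 < gaussDensity x := by
  rw [gaussDensity_eq_prod_gauss1]; exact Finset.prod_pos fun j _ => gauss1_pos _

lemma integral_weakDeriv_le_sobolevNorm_sq {α : ℕ} (f : (Fin d → ℝ) → ℝ)
    {r : Fin d → ℕ} (hr : r ∈ multiIndices α d) :
    ∫ x, weakDeriv r f x ^ 2 * gaussDensity x ≤ sobolevNorm α f ^ 2 := by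
  have h0 : ∀ r : Fin d → ℕ, 0 ≤ ∫ x, weakDeriv r f x ^ 2 * gaussDensity x := fun r =>
    integral_nonneg fun x => mul_nonneg (sq_nonneg _) (gaussDensity_pos x).le
  unfold sobolevNorm
  rw [Real.sq_sqrt (Finset.sum_nonneg fun r _ => h0 r)]
  exact Finset.single_le_sum (f := fun r => ∫ x, weakDeriv r f x ^ 2 * gaussDensity x)
    (fun r _ => h0 r) hr

/-! ### Fourier coefficients of transformed integrands -/

/-- `F` times a product of one-dimensional Gaussians and polynomials. -/
def weighted (F : (Fin d → ℝ) → ℝ) (P : Fin d → ℂ[X]) (x : Fin d → ℝ) : ℂ :=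
  F x * tensorFun (fun j => gaussPoly (P j) 0) x

/-- The Fourier coefficients of the transformed integrand of `weighted F P`. -/
def waveCoeff (F : (Fin d → ℝ) → ℝ) (P : Fin d → ℂ[X]) (k : Fin d → ℤ) : ℂ :=
  ∫ x, (F x : ℂ) * tensorFun (fun j => gaussPoly (P j) (k j)) x

lemma cubeChar_neg_eq {t : Fin d → ℝ} (ht : t ∈ openCube d) (k : Fin d → ℤ) :
    cubeChar (-k) t = ∏ j, waveFun (k j) (cotVec t j) := by
  unfold cubeChar waveFun
  rw [← Complex.exp_sum]
  congr 1
  rw [Finset.sum_neg_distrib, ← Finset.mul_sum, ← mul_neg]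
  congr 1
  push_cast
  rw [← Finset.sum_neg_distrib]
  refine Finset.sum_congr rfl fun j _ => ?_
  rw [cotVec, arcMap_cotMap (mem_openCube.mp ht j)]
  simp [mul_comm]

lemma waveFun_zero (x : ℝ) : waveFun 0 x = 1 := by simp [waveFun]

lemma gaussPoly_zero_mul (P : ℂ[X]) (k : ℤ) (x : ℝ) :
    gaussPoly P k x = gaussPoly P 0 x * waveFun k x := by
  simp [gaussPoly, waveFun_zero]

lemma cubeFourierCoeff_cotPull_weighted (F : (Fin d → ℝ) → ℝ) (P : Fin d → ℂ[X])
    (k : Fin d → ℤ) : cubeFourierCoeff (cotPull (weighted F P)) k = waveCoeff F P k := by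
  rw [cubeFourierCoeff_eq_setIntegral_cubeChar, waveCoeff, ← setIntegral_cotPull]
  congr 1
  ext t
  by_cases ht : t ∈ openCube d
  · rw [cotPull_of_mem ht, cotPull_of_mem ht, cubeChar_neg_eq ht, mul_smul_comm]
    congr 1
    unfold weighted tensorFun
    simp_rw [gaussPoly_zero_mul _ (k _), Finset.prod_mul_distrib]
    ring
  · rw [cotPull_of_notMem ht, cotPull_of_notMem ht, mul_zero]

lemma integrable_weighted {F : (Fin d → ℝ) → ℝ} (hF : AEStronglyMeasurable F volume)
    (hi : Integrable fun x => F x ^ 2 * gaussDensity x) (P : Fin d → ℂ[X]) :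
    Integrable (weighted F P) := by
  have := integrable_mul_tensorFun_of_bound hF hi (fun j => gaussDecay_gaussPoly (P j) 0) 0
  simp only [Pi.zero_apply, iteratedDeriv_zero] at this
  exact this

/-- Squaring gives two Gaussians: one is kept as the weight, the other dominates the polynomial and
the Jacobian. -/
lemma exists_gauss1_mul_le (P : ℂ[X]) :
    ∃ A, 0 ≤ A ∧ ∀ x : ℝ, ‖gaussPoly P 0 x‖ ^ 2 * (π * (1 + x ^ 2)) ≤ A * gauss1 x := by
  obtain ⟨A, hA0, hA⟩ := exists_norm_eval_le (P * P * (1 + X ^ 2))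
  refine ⟨π * A, by positivity, fun x => ?_⟩
  have h1 := hA x
  simp only [eval_mul, eval_add, eval_one, eval_pow, eval_X, norm_mul] at h1
  have h2 : ‖(1 + (x : ℂ) ^ 2)‖ = 1 + x ^ 2 := by
    rw [show (1 + (x : ℂ) ^ 2) = ((1 + x ^ 2 : ℝ) : ℂ) by push_cast; rfl, Complex.norm_real,
      Real.norm_of_nonneg (by positivity)]
  rw [h2] at h1
  have hg0 := gauss1_pos x
  unfold gaussPoly
  rw [norm_mul, norm_waveFun, mul_one, norm_mul, Complex.norm_real, Real.norm_of_nonneg hg0.le]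
  have h3 : gauss1 x * Real.exp (1 / 8 * x ^ 2) ≤ 1 := by
    calc _ ≤ Real.exp (-(1 / 2) * x ^ 2) * Real.exp (1 / 8 * x ^ 2) := by
          gcongr; exact gauss1_le x
      _ ≤ 1 := by
          rw [← Real.exp_add, Real.exp_le_one_iff]
          nlinarith [sq_nonneg x]
  calc _ = π * gauss1 x * (gauss1 x * (‖eval (x : ℂ) P‖ * ‖eval (x : ℂ) P‖ * (1 + x ^ 2))) := by ring
    _ ≤ π * gauss1 x * (gauss1 x * (A * Real.exp (1 / 8 * x ^ 2))) := by gcongr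
    _ = π * gauss1 x * A * (gauss1 x * Real.exp (1 / 8 * x ^ 2)) := by ring
    _ ≤ π * gauss1 x * A * 1 := by gcongr
    _ = _ := by ring

lemma exists_norm_weighted_sq_le (P : Fin d → ℂ[X]) :
    ∃ A, 0 ≤ A ∧ ∀ (F : (Fin d → ℝ) → ℝ) (x : Fin d → ℝ),
      ‖weighted F P x‖ ^ 2 * cotJac x ≤ A * (F x ^ 2 * gaussDensity x) := by
  choose A hA0 hA using fun j => exists_gauss1_mul_le (P j)
  refine ⟨∏ j, A j, Finset.prod_nonneg fun j _ => hA0 j, fun F x => ?_⟩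
  have h1 : ‖tensorFun (fun j => gaussPoly (P j) 0) x‖ ^ 2 * cotJac x
      ≤ (∏ j, A j) * gaussDensity x := by
    unfold tensorFun cotJac
    rw [norm_prod, ← Finset.prod_pow, ← Finset.prod_mul_distrib, gaussDensity_eq_prod_gauss1,
      ← Finset.prod_mul_distrib]
    refine Finset.prod_le_prod (fun j _ => ?_) fun j _ => hA j _
    have := Real.pi_pos
    positivity
  unfold weighted
  rw [norm_mul, Complex.norm_real, mul_pow, Real.norm_eq_abs, sq_abs]
  calc _ = F x ^ 2 * (‖tensorFun (fun j => gaussPoly (P j) 0) x‖ ^ 2 * cotJac x) := by ring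
    _ ≤ F x ^ 2 * ((∏ j, A j) * gaussDensity x) := by gcongr
    _ = _ := by ring

lemma norm_cotPull_sq (H : (Fin d → ℝ) → ℂ) :
    (fun t => ‖cotPull H t‖ ^ 2) = cotPull fun x => ‖H x‖ ^ 2 * cotJac x := by
  ext t
  by_cases ht : t ∈ openCube d
  · rw [cotPull_of_mem ht, cotPull_of_mem ht, norm_smul, Real.norm_of_nonneg (cotJac_pos _).le,
      smul_eq_mul]
    ring
  · rw [cotPull_of_notMem ht, cotPull_of_notMem ht]; simp

lemma memLp_cotPull_weighted {F : (Fin d → ℝ) → ℝ} (hF : AEStronglyMeasurable F volume)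
    (hi : Integrable fun x => F x ^ 2 * gaussDensity x) (P : Fin d → ℂ[X]) :
    MemLp (cotPull (weighted F P)) 2 (volume.restrict (Set.Icc (0 : Fin d → ℝ) 1)) := by
  have hint := integrable_weighted hF hi P
  rw [memLp_two_iff_integrable_sq_norm (integrableOn_cotPull.mpr hint).aestronglyMeasurable,
    norm_cotPull_sq]
  refine integrableOn_cotPull.mpr ?_
  obtain ⟨A, -, hA⟩ := exists_norm_weighted_sq_le P
  refine (hi.const_mul A).mono' ?_ (Filter.Eventually.of_forall fun x => ?_)
  · exact (hint.aestronglyMeasurable.norm.pow 2).mul continuous_cotJac.aestronglyMeasurable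
  · rw [Real.norm_of_nonneg (mul_nonneg (sq_nonneg _) (cotJac_pos x).le)]
    exact hA F x

/-- Parseval on the cube. The square of the pulled-back function carries the Jacobian twice; one
factor is used by the change of variables, and `exists_norm_weighted_sq_le` absorbs the other. -/
lemma exists_sum_waveCoeff_le (P : Fin d → ℂ[X]) :
    ∃ A, 0 ≤ A ∧ ∀ (F : (Fin d → ℝ) → ℝ), AEStronglyMeasurable F volume →
      (Integrable fun x => F x ^ 2 * gaussDensity x) →
      (Summable fun k => ‖waveCoeff F P k‖ ^ 2) ∧
        ∑' k, ‖waveCoeff F P k‖ ^ 2 ≤ A * ∫ x, F x ^ 2 * gaussDensity x := by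
  obtain ⟨A, hA0, hA⟩ := exists_norm_weighted_sq_le P
  refine ⟨A, hA0, fun F hF hi => ?_⟩
  have h := hasSum_sq_cubeFourierCoeff (memLp_cotPull_weighted hF hi P)
  simp_rw [cubeFourierCoeff_cotPull_weighted] at h
  refine ⟨h.summable, ?_⟩
  rw [h.tsum_eq, norm_cotPull_sq, setIntegral_cotPull, ← integral_const_mul]
  refine integral_mono_of_nonneg (Filter.Eventually.of_forall fun x =>
    mul_nonneg (sq_nonneg _) (cotJac_pos x).le) (hi.const_mul A)
    (Filter.Eventually.of_forall fun x => hA F x)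

/-- Since `max(1, a)² ≤ 1 + a²`, the product expands over subsets `u`: those coordinates that
receive `α` derivatives. -/
lemma korobovWeight_sq_le (α : ℕ) (k : Fin d → ℤ) :
    korobovWeight α k ^ 2 ≤ ∑ u : Finset (Fin d), ‖∏ j ∈ u, (k j : ℂ) ^ α‖ ^ 2 := by
  unfold korobovWeight
  rw [← Finset.prod_pow]
  calc _ ≤ ∏ j, (1 + ‖(k j : ℂ) ^ α‖ ^ 2) := by
        refine Finset.prod_le_prod (fun j _ => by positivity) fun j _ => ?_
        rw [norm_pow, Complex.norm_intCast]
        rcases max_cases 1 (|(k j : ℝ)| ^ α) with ⟨h, -⟩ | ⟨h, -⟩ <;> rw [h] <;>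
          nlinarith [sq_nonneg (|(k j : ℝ)| ^ α)]
    _ = _ := by
        rw [Finset.prod_one_add, Finset.powerset_univ]
        refine Finset.sum_congr rfl fun u _ => ?_
        rw [norm_prod, Finset.prod_pow]

/-- Multiplication by powers of the frequencies is a mixed derivative. -/
lemma exists_prod_pow_mul_tensorFun (α : ℕ) (p : Fin d → ℂ[X]) (u : Finset (Fin d)) :
    ∃ B : Fin d → ℕ → ℂ[X], ∀ (k : Fin d → ℤ) (x : Fin d → ℝ),
      (∏ j ∈ u, (k j : ℂ) ^ α) * tensorFun (fun j => gaussPoly (p j) (k j)) x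
        = ∑ r ∈ multiIndices α d,
          tensorFun (fun j => iteratedDeriv (r j) (gaussPoly (B j (r j)) (k j))) x := by
  classical
  choose A hA using fun j => exists_pow_mul_gaussPoly α (p j)
  -- Coordinates outside `u` are not differentiated. Padding them with zero polynomials at positive
  -- orders lets every factor be a sum over `r ≤ α`, so the product expands over `multiIndices α d`.
  refine ⟨fun j r => if j ∈ u then A j r else if r = 0 then p j else 0, fun k x => ?_⟩
  have hz : ∀ (n : ℕ) (m : ℤ) (y : ℝ), iteratedDeriv n (gaussPoly 0 m) y = 0 := fun n m y => by
    have : gaussPoly 0 m = fun _ => 0 := by ext y; simp [gaussPoly]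
    rw [this]; simp
  unfold tensorFun multiIndices
  rw [← Finset.prod_univ_sum (fun _ => Finset.range (α + 1)) fun j r => iteratedDeriv r
    (gaussPoly (if j ∈ u then A j r else if r = 0 then p j else 0) (k j)) (x j)]
  have hu : ∏ j ∈ u, (k j : ℂ) ^ α = ∏ j, if j ∈ u then (k j : ℂ) ^ α else 1 := by
    rw [Finset.prod_ite_mem, Finset.univ_inter]
  rw [hu, ← Finset.prod_mul_distrib]
  refine Finset.prod_congr rfl fun j _ => ?_
  by_cases hj : j ∈ u
  · simp only [if_pos hj]; exact hA j (k j) (x j)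
  · simp only [if_neg hj, one_mul]
    rw [Finset.sum_eq_single 0]
    · simp
    · intro r _ hr
      rw [if_neg hr, hz]
    · simp

/-- The norm estimate behind the theorem. For each `u`, the coefficient times `∏_{j ∈ u} k_j^α` is a
signed sum of coefficients of weak derivatives of `f`, each square summable by Parseval with a
constant independent of `f`. -/
lemma exists_korobov_le (α : ℕ) (p : Fin d → ℂ[X]) :
    ∃ A, 0 ≤ A ∧ ∀ f : (Fin d → ℝ) → ℝ, MemSobolev α f →
      (Summable fun k => ‖waveCoeff f p k‖ ^ 2 * korobovWeight α k ^ 2) ∧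
        ∑' k, ‖waveCoeff f p k‖ ^ 2 * korobovWeight α k ^ 2 ≤ A * sobolevNorm α f ^ 2 := by
  classical
  choose B hB using exists_prod_pow_mul_tensorFun α p
  choose A hA0 hA using fun (u : Finset (Fin d)) (r : Fin d → ℕ) =>
    exists_sum_waveCoeff_le (fun j => B u j (r j))
  set M := multiIndices α d with hM
  refine ⟨∑ u : Finset (Fin d), ∑ r ∈ M, M.card * A u r, Finset.sum_nonneg fun u _ =>
    Finset.sum_nonneg fun r _ => mul_nonneg (by positivity) (hA0 u r), fun f hf => ?_⟩
  have hfm := hf.locallyIntegrable.aestronglyMeasurable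
  have hterm : ∀ (k : Fin d → ℤ) (u : Finset (Fin d)),
      ‖waveCoeff f p k‖ ^ 2 * ‖∏ j ∈ u, (k j : ℂ) ^ α‖ ^ 2
        ≤ ∑ r ∈ M, M.card * ‖waveCoeff (weakDeriv r f) (fun j => B u j (r j)) k‖ ^ 2 := by
    intro k u
    have e : (∏ j ∈ u, (k j : ℂ) ^ α) * waveCoeff f p k
        = ∑ r ∈ M, (-1) ^ (∑ i, r i) * waveCoeff (weakDeriv r f) (fun j => B u j (r j)) k := by
      unfold waveCoeff
      rw [← integral_const_mul]
      simp_rw [mul_left_comm _ (f _ : ℂ), hB u k, Finset.mul_sum]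
      rw [integral_finsetSum]
      · refine Finset.sum_congr rfl fun r hr => ?_
        exact (hf.isWeakDeriv hr).integral_tensorFun hf.integrable_sq (hf.integrable_weakDeriv hr)
          fun j => gaussDecay_gaussPoly _ _
      · intro r _
        exact integrable_mul_tensorFun_of_bound hfm hf.integrable_sq
          (fun j => gaussDecay_gaussPoly _ _) r
    rw [← mul_pow, mul_comm, ← norm_mul, e, ← Finset.mul_sum]
    refine (pow_le_pow_left₀ (norm_nonneg _) (norm_sum_le _ _) 2).trans ?_
    refine sq_sum_le_card_mul_sum_sq.trans (le_of_eq ?_)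
    congr 1
    refine Finset.sum_congr rfl fun r _ => ?_
    rw [norm_mul, norm_pow, norm_neg, norm_one, one_pow, one_mul]
  have hle : ∀ k, ‖waveCoeff f p k‖ ^ 2 * korobovWeight α k ^ 2 ≤ ∑ u : Finset (Fin d), ∑ r ∈ M,
      M.card * ‖waveCoeff (weakDeriv r f) (fun j => B u j (r j)) k‖ ^ 2 := by
    intro k
    calc _ ≤ ‖waveCoeff f p k‖ ^ 2 * ∑ u : Finset (Fin d), ‖∏ j ∈ u, (k j : ℂ) ^ α‖ ^ 2 := by
          gcongr; exact korobovWeight_sq_le α k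
      _ ≤ _ := by
          rw [Finset.mul_sum]
          exact Finset.sum_le_sum fun u _ => hterm k u
  have hD : ∀ u, ∀ r ∈ M, _ := fun u r hr => hA u r (weakDeriv r f)
    (hf.isWeakDeriv hr).2.1.aestronglyMeasurable (hf.integrable_weakDeriv hr)
  have hsr : ∀ u, ∀ r ∈ M, Summable fun k =>
      (M.card : ℝ) * ‖waveCoeff (weakDeriv r f) (fun j => B u j (r j)) k‖ ^ 2 :=
    fun u r hr => (hD u r hr).1.mul_left _
  have hsu : ∀ u, Summable fun k => ∑ r ∈ M,
      (M.card : ℝ) * ‖waveCoeff (weakDeriv r f) (fun j => B u j (r j)) k‖ ^ 2 :=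
    fun u => summable_sum (hsr u)
  have hs := summable_sum (s := (Finset.univ : Finset (Finset (Fin d)))) fun u _ => hsu u
  have hsum : Summable fun k => ‖waveCoeff f p k‖ ^ 2 * korobovWeight α k ^ 2 :=
    Summable.of_nonneg_of_le (fun k => by positivity) hle hs
  refine ⟨hsum, (hsum.tsum_le_tsum hle hs).trans ?_⟩
  rw [Summable.tsum_finsetSum fun u _ => hsu u, Finset.sum_mul]
  refine Finset.sum_le_sum fun u _ => ?_
  rw [Summable.tsum_finsetSum (hsr u), Finset.sum_mul]
  refine Finset.sum_le_sum fun r hr => ?_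
  rw [tsum_mul_left, mul_assoc]
  gcongr
  exact (hD u r hr).2.trans (mul_le_mul_of_nonneg_left
    (integral_weakDeriv_le_sobolevNorm_sq f hr) (hA0 u r))

end KorobovEstimate

/-! ### The worst-case error of the lattice rule with cotangent transform -/

section WorstCase

open Polynomial

variable {d : ℕ}

/-- The Fourier series of the transformed integrand of `weighted F P`. -/
def waveSeries (F : (Fin d → ℝ) → ℝ) (P : Fin d → ℂ[X]) (t : Fin d → ℝ) : ℂ :=
  ∑' k, waveCoeff F P k * cubeChar k t

lemma MemSobolev.summable_norm_waveCoeff {α : ℕ} (hα : 1 ≤ α) {f : (Fin d → ℝ) → ℝ}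
    (hf : MemSobolev α f) (P : Fin d → ℂ[X]) : Summable fun k => ‖waveCoeff f P k‖ := by
  obtain ⟨A, -, hA⟩ := exists_korobov_le α P
  exact summable_norm_of_summable_korobov hα (hA f hf).1

lemma MemSobolev.continuous_waveSeries {α : ℕ} (hα : 1 ≤ α) {f : (Fin d → ℝ) → ℝ}
    (hf : MemSobolev α f) (P : Fin d → ℂ[X]) : Continuous (waveSeries f P) :=
  continuous_tsum_cubeChar (hf.summable_norm_waveCoeff hα P)

lemma MemSobolev.memLp_cotPull_weighted {α : ℕ} {f : (Fin d → ℝ) → ℝ} (hf : MemSobolev α f)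
    (P : Fin d → ℂ[X]) :
    MemLp (cotPull (weighted f P)) 2 (volume.restrict (Set.Icc (0 : Fin d → ℝ) 1)) :=
  GaussQMC.memLp_cotPull_weighted hf.locallyIntegrable.aestronglyMeasurable hf.integrable_sq P

lemma MemSobolev.waveSeries_ae_eq {α : ℕ} (hα : 1 ≤ α) {f : (Fin d → ℝ) → ℝ}
    (hf : MemSobolev α f) (P : Fin d → ℂ[X]) :
    waveSeries f P =ᵐ[volume.restrict (Set.Icc 0 1)] cotPull (weighted f P) := by
  have hs := hf.summable_norm_waveCoeff hα P
  simp only [← cubeFourierCoeff_cotPull_weighted] at hs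
  have h := tsum_cubeFourierCoeff_ae_eq (hf.memLp_cotPull_weighted P) hs
  simp only [cubeFourierCoeff_cotPull_weighted] at h
  exact h

lemma weighted_apply (F : (Fin d → ℝ) → ℝ) (P : Fin d → ℂ[X]) (x : Fin d → ℝ) :
    weighted F P x = F x * gaussDensity x * ∏ j, (P j).eval (x j : ℂ) := by
  rw [gaussDensity_eq_prod_gauss1]
  simp only [weighted, tensorFun, gaussPoly, waveFun_zero, mul_one, Finset.prod_mul_distrib]
  push_cast
  ring

lemma cotIntegrand_eq_cotPull_weighted_one (f : (Fin d → ℝ) → ℝ) :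
    (fun t => (cotIntegrand f t : ℂ)) = cotPull (weighted f 1) := by
  rw [cotIntegrand_eq_cotPull]
  ext t
  by_cases ht : t ∈ openCube d
  · rw [cotPull_of_mem ht, cotPull_of_mem ht, weighted_apply]
    simp
  · rw [cotPull_of_notMem ht, cotPull_of_notMem ht, Complex.ofReal_zero]

/-! ### Continuity up to the boundary of the cube -/

/-- The function `∏ sin²(π t_j)`, which vanishes on the boundary of the cube. -/
def sinProd (t : Fin d → ℝ) : ℝ := ∏ j, Real.sin (π * t j) ^ 2

lemma continuous_sinProd : Continuous (sinProd (d := d)) := by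
  unfold sinProd; fun_prop

lemma sinProd_eq_zero {t : Fin d → ℝ} (h : t ∈ Set.Icc 0 1) (ht : t ∉ openCube d) :
    sinProd t = 0 := by
  rw [mem_openCube] at ht
  push Not at ht
  obtain ⟨k, hk⟩ := ht
  refine Finset.prod_eq_zero (Finset.mem_univ k) ?_
  have h0 : 0 ≤ t k := h.1 k
  have h1 : t k ≤ 1 := h.2 k
  rcases h0.eq_or_lt with h0 | h0
  · rw [← h0]; simp
  · rcases h1.eq_or_lt with h1 | h1
    · rw [h1]; simp
    · exact absurd ⟨h0, h1⟩ hk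

/-- Moves the factor `∏ (1 + x_j²)` into the polynomial weight, where the Korobov estimate still
applies, and leaves a factor that vanishes on the boundary. -/
lemma cotIntegrand_eq_mul_sinProd (f : (Fin d → ℝ) → ℝ) (t : Fin d → ℝ) :
    (cotIntegrand f t : ℂ) = cotPull (weighted f fun _ => 1 + X ^ 2) t * sinProd t := by
  rw [cotIntegrand_eq_cotPull]
  by_cases ht : t ∈ openCube d
  · have h : (∏ j, (1 + (cotMap (t j) : ℂ) ^ 2)) * (sinProd t : ℂ) = 1 := by
      have h1 : (∏ j, (1 + cotMap (t j) ^ 2)) * sinProd t = 1 := by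
        rw [sinProd, ← Finset.prod_mul_distrib]
        exact Finset.prod_eq_one fun j _ => one_add_cotMap_sq (mem_openCube.mp ht j)
      exact_mod_cast congrArg Complex.ofReal h1
    rw [cotPull_of_mem ht, cotPull_of_mem ht, weighted_apply]
    simp only [smul_eq_mul, Complex.real_smul, eval_add, eval_one, eval_pow, eval_X]
    change _ = _ * (_ * ∏ j, (1 + (cotMap (t j) : ℂ) ^ 2)) * _
    push_cast
    linear_combination (-(cotJac (cotVec t) : ℂ) * f (cotVec t) * gaussDensity (cotVec t)) * h
  · rw [cotPull_of_notMem ht, cotPull_of_notMem ht, Complex.ofReal_zero, zero_mul]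

lemma MemSobolev.memKorobov {α : ℕ} {f : (Fin d → ℝ) → ℝ} (hf : MemSobolev α f) :
    MemKorobov α fun t => (cotIntegrand f t : ℂ) := by
  rw [cotIntegrand_eq_cotPull_weighted_one]
  refine ⟨hf.memLp_cotPull_weighted 1, ?_⟩
  simp only [cubeFourierCoeff_cotPull_weighted]
  obtain ⟨A, -, hA⟩ := exists_korobov_le (d := d) α 1
  exact (hA f hf).1

lemma continuous_gaussDensity : Continuous (gaussDensity (d := d)) := by
  unfold gaussDensity; fun_prop

lemma continuous_arcVec : Continuous (arcVec (d := d)) := by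
  unfold arcVec arcMap; fun_prop

/-- The Fourier series of the transformed integrand is continuous; transport it back to `ℝ^d` and
divide by the positive continuous function `cotJac · gaussDensity`. -/
lemma MemSobolev.exists_continuous {α : ℕ} (hα : 1 ≤ α) {f : (Fin d → ℝ) → ℝ}
    (hf : MemSobolev α f) : ∃ f₀ : (Fin d → ℝ) → ℝ, Continuous f₀ ∧ f₀ =ᵐ[volume] f := by
  have hpos : ∀ x : Fin d → ℝ, cotJac x * gaussDensity x ≠ 0 := fun x =>
    (mul_pos (cotJac_pos x) (gaussDensity_pos x)).ne'
  refine ⟨fun x => (waveSeries f 1 (arcVec x)).re / (cotJac x * gaussDensity x),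
    (Complex.continuous_re.comp ((hf.continuous_waveSeries hα 1).comp continuous_arcVec)).div
      (continuous_cotJac.mul continuous_gaussDensity) hpos, ?_⟩
  refine ae_of_ae_cube ?_
  filter_upwards [hf.waveSeries_ae_eq hα 1] with t h ht
  rw [arcVec_cotVec ht, h, cotPull_of_mem ht, weighted_apply, div_eq_iff (hpos _)]
  simp only [Pi.one_apply, eval_one, Finset.prod_const_one, mul_one, Complex.real_smul,
    ← Complex.ofReal_mul, Complex.ofReal_re]
  ring

lemma continuousOn_cotIntegrand {f : (Fin d → ℝ) → ℝ} (hc : Continuous f) :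
    ContinuousOn (cotIntegrand f) (openCube d) := by
  have hv : ContinuousOn cotVec (openCube d) := fun t ht =>
    (hasFDerivAt_cotVec ht).continuousAt.continuousWithinAt
  have h := (continuous_cotJac.mul (hc.mul continuous_gaussDensity)).comp_continuousOn hv
  refine h.congr fun t ht => ?_
  rw [cotIntegrand_eq_cotPull, cotPull_of_mem ht]
  rfl

/-- The boundary matters: the lattice point with `j = N` is the origin. In the open cube both sides
are continuous and agree almost everywhere. On the whole closed cube the series equals `sinProd`
times another continuous series, so on the boundary it is `0`, the value of the extension. -/
lemma MemSobolev.eqOn_waveSeries {α : ℕ} (hα : 1 ≤ α) {f : (Fin d → ℝ) → ℝ}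
    (hf : MemSobolev α f) (hc : Continuous f) :
    Set.EqOn (fun t => (cotIntegrand f t : ℂ)) (waveSeries f 1) (Set.Icc 0 1) := by
  have h1 := hf.waveSeries_ae_eq hα 1
  rw [← cotIntegrand_eq_cotPull_weighted_one] at h1
  have hK := hf.continuous_waveSeries hα 1
  intro t ht
  by_cases hto : t ∈ openCube d
  · refine Measure.eqOn_open_of_ae_eq (μ := volume) ?_ isOpen_openCube
      (Complex.continuous_ofReal.comp_continuousOn (continuousOn_cotIntegrand hc))
      hK.continuousOn hto
    exact (h1.filter_mono (ae_mono (Measure.restrict_mono openCube_subset le_rfl))).symm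
  · have hH : Continuous fun t => waveSeries f (fun _ => 1 + X ^ 2) t * (sinProd t : ℂ) :=
      (hf.continuous_waveSeries hα _).mul (Complex.continuous_ofReal.comp continuous_sinProd)
    have h2 := continuousOn_eq_on_cube hK.continuousOn hH.continuousOn (h1.trans (by
      filter_upwards [hf.waveSeries_ae_eq hα fun _ => 1 + X ^ 2] with s hs
      rw [hs, cotIntegrand_eq_mul_sinProd])) ht
    rw [h2]
    simp only [cotIntegrand_eq_mul_sinProd f t, sinProd_eq_zero ht hto, Complex.ofReal_zero,
      mul_zero]

/-- The error of the lattice rule with cotangent transform is bounded by the Sobolev norm times the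
Korobov worst-case error. -/
lemma exists_abs_gaussIntegral_sub_le {α : ℕ} (hα : 1 ≤ α) (d : ℕ) :
    ∃ A : ℝ, 0 ≤ A ∧ ∀ (N : ℕ), N ≠ 0 → ∀ (z : Fin d → ℕ) (f : (Fin d → ℝ) → ℝ), Continuous f →
      MemSobolev α f → |gaussIntegral f - cotLatticeRule N z f| ≤
        A * √(latSum (2 * α) N z).toReal * sobolevNorm α f := by
  obtain ⟨A, hA0, hA⟩ := exists_korobov_le (d := d) α 1
  refine ⟨√A, Real.sqrt_nonneg _, fun N hN z f hc hf => ?_⟩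
  have heq := hf.eqOn_waveSeries hα hc
  have hI : (gaussIntegral f : ℂ) = ∫ t in Set.Icc (0 : Fin d → ℝ) 1, waveSeries f 1 t := by
    rw [gaussIntegral, ← setIntegral_cotPull, ← cotIntegrand_eq_cotPull, ← integral_complex_ofReal]
    exact setIntegral_congr_fun measurableSet_Icc heq
  have hQ : (cotLatticeRule N z f : ℂ) = latticeRule N z (waveSeries f 1) := by
    unfold cotLatticeRule latticeRule
    push_cast
    congr 1
    exact Finset.sum_congr rfl fun j _ => heq (latticePoint_mem N z j)
  have h := norm_integral_sub_latticeRule_le hα hN z (hA f hf).1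
  change ‖(∫ t in Set.Icc (0 : Fin d → ℝ) 1, waveSeries f 1 t)
    - latticeRule N z (waveSeries f 1)‖ ≤ _ at h
  rw [← hI, ← hQ, ← Complex.ofReal_sub, Complex.norm_real, Real.norm_eq_abs] at h
  have hs : 0 ≤ sobolevNorm α f := Real.sqrt_nonneg _
  have h3 : √(∑' k, ‖waveCoeff f 1 k‖ ^ 2 * korobovWeight α k ^ 2) ≤ √A * sobolevNorm α f := by
    rw [← Real.sqrt_sq hs, ← Real.sqrt_mul hA0]
    exact Real.sqrt_le_sqrt (hA f hf).2
  calc _ ≤ _ := h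
    _ ≤ √A * sobolevNorm α f * √(latSum (2 * α) N z).toReal :=
      mul_le_mul_of_nonneg_right h3 (Real.sqrt_nonneg _)
    _ = _ := by ring

lemma sqrt_latSum_isCBC_le {α N : ℕ} (hα : 1 ≤ α) (hN : 2 ≤ N) {z : Fin d → ℕ}
    (hz : IsCBC α N z) : √(latSum (2 * α) N z).toReal ≤
      √(d * (10 ^ (2 * α * d) * Real.exp (4 * α))) * (((N : ℝ) ^ α)⁻¹ * Real.log N ^ (d * α)) := by
  have hlog : 0 ≤ ((N : ℝ) ^ α)⁻¹ * Real.log N ^ (d * α) :=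
    mul_nonneg (by positivity) (pow_nonneg (Real.log_natCast_nonneg N) _)
  have h := ENNReal.toReal_mono ENNReal.ofReal_ne_top (latSum_isCBC_le hα hN hz)
  rw [ENNReal.toReal_ofReal (by positivity), ← mul_assoc] at h
  refine (Real.sqrt_le_sqrt h).trans_eq ?_
  rw [← mul_assoc, Real.sqrt_mul' _ (sq_nonneg _), Real.sqrt_sq hlog, mul_assoc (d : ℝ)]

lemma exists_sobolevWorstCaseError_le {α : ℕ} (hα : 1 ≤ α) (d : ℕ) :
    ∃ C : ℝ, 0 < C ∧ ∀ N : ℕ, 2 ≤ N → ∀ z : Fin d → ℕ, IsCBC α N z →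
      sobolevWorstCaseError α N z ≤
        ENNReal.ofReal (C * ((N : ℝ) ^ α)⁻¹ * Real.log N ^ (d * α)) := by
  obtain ⟨A, hA0, hA⟩ := exists_abs_gaussIntegral_sub_le hα d
  set K := √(d * (10 ^ (2 * α * d) * Real.exp (4 * α)))
  -- The summand `1` only ensures positivity.
  refine ⟨A * K + 1, by positivity, fun N hN z hz => ?_⟩
  have hB : 0 ≤ ((N : ℝ) ^ α)⁻¹ * Real.log N ^ (d * α) :=
    mul_nonneg (by positivity) (pow_nonneg (Real.log_natCast_nonneg N) _)
  rw [mul_assoc]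
  refine iSup_le fun f => iSup_le fun hc => iSup_le fun hf => iSup_le fun _ =>
    ENNReal.ofReal_le_ofReal (div_le_of_le_mul₀ (Real.sqrt_nonneg _) (by positivity) ?_)
  refine (hA N (by omega) z f hc hf).trans
    (mul_le_mul_of_nonneg_right ?_ (Real.sqrt_nonneg _))
  calc _ ≤ A * (K * (((N : ℝ) ^ α)⁻¹ * Real.log N ^ (d * α))) :=
        mul_le_mul_of_nonneg_left (sqrt_latSum_isCBC_le hα hN hz) hA0
    _ ≤ _ := by linarith

end WorstCase

end GaussQMC

end

theorem mainTheorem5 (d α : ℕ) (hd : 1 ≤ d) (hα : 1 ≤ α) :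
    -- every element of the Gaussian Sobolev space has a continuous representative, and its
    -- transformed integrand lies in the Korobov space of smoothness `α`
    (∀ f : (Fin d → ℝ) → ℝ, GaussQMC.MemSobolev α f →
      (∃ f₀ : (Fin d → ℝ) → ℝ, Continuous f₀ ∧ f₀ =ᵐ[MeasureTheory.volume] f) ∧
      GaussQMC.MemKorobov α (fun t => (GaussQMC.cotIntegrand f t : ℂ))) ∧
    -- worst-case error bound, with a constant depending only on `α` and `d`
    ∃ C : ℝ, 0 < C ∧ ∀ N : ℕ, 2 ≤ N →
      (∃ z : Fin d → ℕ, GaussQMC.IsCBC α N z) ∧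
      ∀ z : Fin d → ℕ, GaussQMC.IsCBC α N z →
        GaussQMC.sobolevWorstCaseError α N z ≤
          ENNReal.ofReal (C * ((N : ℝ) ^ α)⁻¹ * Real.log N ^ (d * α)) := by
  obtain ⟨C, hC0, hC⟩ := GaussQMC.exists_sobolevWorstCaseError_le hα d
  exact ⟨fun f hf => ⟨hf.exists_continuous hα, hf.memKorobov⟩,
    C, hC0, fun N hN => ⟨GaussQMC.exists_isCBC α hN, hC N hN⟩⟩
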